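/- **Proposition 5.1 (Staude's vertex configuration).** Let $a_1>a_2>a_3$ be real and, for $u\in\mathbb R\setminus\{a_1,a_2,a_3\}$, let $Q_u=\{x\in\mathbb R^3:\sum_j (x^j)^2/(a_j-u)=1\}$ be the quadrics of the confocal family; $Q_u$ is an ellipsoid, written $\{u^3=u\}$, if $u<a_3$, and a hyperboloid with one sheet, written $\{u^2=u\}$, if $a_3<u<a_2$. Fix $u^3_0<a_3<u^2_0<a_2$. Let $\gamma_1:I_1\to\{u^3=u^3_0\}$ and $\gamma_2:I_2\to\{u^3=u^3_0\}$ be geodesics of the ellipsoid, parametrized by arc length on open intervals, all of whose tangent lines are tangent to $\{u^2=u^2_0\}$ (a contact at infinity is allowed). Let $M$ be the set of $(s,t,r,q)\in I_1\times(0,\infty)\times I_2\times(0,\infty)$ with $$P:=\gamma_1(s)+t\,\gamma_1'(s)=\gamma_2(r)-q\,\gamma_2'(r),$$ that is, the set of meetings of the forward part of the tangent surface of $\gamma_1$ with the backward part of the tangent surface of $\gamma_2$. Let $V\subseteq M$ be the set of vertices: the meetings at which $\gamma_2'(r)$ is the reflection of $\gamma_1'(s)$ in the tangent plane at $P$ of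 the confocal ellipsoid through $P$. Then: 1. If $p_0=(s_0,t_0,r_0,q_0)\in V$ and its point $P_0$ does not lie on $\{u^2=u^2_0\}$, then near $p_0$ the set $M$ is a $C^1$ curve parametrized by $s$ in an open interval around $s_0$, all of its points belong to $V$, and $s\mapsto P$ has nowhere vanishing derivative on it. 2. For every connected $C\subseteq V$ there is $u^3_1<u^3_0$ such that the points $P$ of all elements of $C$ lie on the confocal ellipsoid $\{u^3=u^3_1\}$. Moreover, for all $\alpha\in I_1$ and $\beta\in I_2$, the length of the thread that runs from the fixed point $\gamma_1(\alpha)$ along $\gamma_1$ to $\gamma_1(s)$, straight to the vertex $P$, straight to $\gamma_2(r)$, and along $\gamma_2$ to the fixed point $\gamma_2(\beta)$, is the same for all elements $(s,t,r,q)$ of $C$. (An arc of $\gamma_1$ or $\gamma_2$ that is run through backwards is counted with a minus sign.) In particular, near a vertex as in 1 the two parts of the tangent surfaces meet along a regular curve on a confocal ellipsoid $\{u^3=u^3_1\}$ with $u^3_1<u^3_0$, and the length of the thread is constant along that curve. -/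

import Mathlib

open Set Topology

namespace Confocal

/-- Euclidean three-space. -/
abbrev E3 : Type := EuclideanSpace ℝ (Fin 3)

/-- The left-hand side `∑ⱼ xⱼ² / (aⱼ - u) - 1` of the equation of the confocal quadric with
parameter `u`. -/
noncomputable def Q (a : Fin 3 → ℝ) (u : ℝ) (x : E3) : ℝ :=
  ∑ j, x j ^ 2 / (a j - u) - 1

/-- The quadric with parameter `u` of the confocal family `∑ⱼ xⱼ² / (aⱼ - u) = 1`.
For `a 0 > a 1 > a 2` it is the ellipsoid `{u³ = u}` if `u < a 2` and the hyperboloid with one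
sheet `{u² = u}` if `a 2 < u < a 1`. -/
def quadric (a : Fin 3 → ℝ) (u : ℝ) : Set E3 := {x | Q a u x = 0}

/-- The normal vector (half the gradient of `Q a u`) at `x` of the confocal quadric with
parameter `u`. -/
noncomputable def normal (a : Fin 3 → ℝ) (u : ℝ) (x : E3) : E3 :=
  WithLp.toLp 2 (fun j => x j / (a j - u))

/-- The line `{x + t v}` is tangent to the confocal quadric with parameter `u`: the equation
`Q a u (x + t v) = A t² + 2 B t + C = 0` in `t` has a double root, that is `B² = A C`.
As usual for quadrics, the point of contact may be at infinity. -/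
def LineTangent (a : Fin 3 → ℝ) (u : ℝ) (x v : E3) : Prop :=
  v ≠ 0 ∧
    (∑ j, x j * v j / (a j - u)) ^ 2 = (∑ j, v j ^ 2 / (a j - u)) * Q a u x

/-- `γ`, restricted to the open interval `I`, is a geodesic of the confocal quadric with parameter
`u`, parametrized by arc length: the acceleration is normal to the quadric. -/
structure IsGeodesicOn (a : Fin 3 → ℝ) (u : ℝ) (γ : ℝ → E3) (I : Set ℝ) : Prop where
  isOpen : IsOpen I
  ordConnected : I.OrdConnected
  contDiffOn : ContDiffOn ℝ 2 γ I
  mem_quadric : ∀ s ∈ I, γ s ∈ quadric a u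
  unit_speed : ∀ s ∈ I, ‖deriv γ s‖ = 1
  acceleration : ∀ s ∈ I, ∃ k : ℝ, deriv (deriv γ) s = k • normal a u (γ s)

/-- All tangent lines of `γ` on `I` are tangent to the confocal quadric with parameter `u`. -/
def TangentsTangentTo (a : Fin 3 → ℝ) (u : ℝ) (γ : ℝ → E3) (I : Set ℝ) : Prop :=
  ∀ s ∈ I, LineTangent a u (γ s) (deriv γ s)

/-- The point at the (signed) distance `t` from `γ s` on the tangent of `γ` at `γ s`.
The forward part of the tangent surface is given by `t > 0`, the backward part by `t < 0`. -/
noncomputable def tangentPoint (γ : ℝ → E3) (s t : ℝ) : E3 := γ s + t • deriv γ s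

/-- The parameters `(s, t, r, q)` at which the forward part of the tangent surface of `γ₁` meets
the backward part of the tangent surface of `γ₂`. -/
def meetSet (γ₁ γ₂ : ℝ → E3) (I₁ I₂ : Set ℝ) : Set (ℝ × ℝ × ℝ × ℝ) :=
  {p | p.1 ∈ I₁ ∧ 0 < p.2.1 ∧ p.2.2.1 ∈ I₂ ∧ 0 < p.2.2.2 ∧
    tangentPoint γ₁ p.1 p.2.1 = tangentPoint γ₂ p.2.2.1 (-p.2.2.2)}

/-- The point of space that belongs to the parameters `(s, t, r, q)`. -/
noncomputable def meetPoint (γ₁ : ℝ → E3) (p : ℝ × ℝ × ℝ × ℝ) : E3 :=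
  tangentPoint γ₁ p.1 p.2.1

/-- At the vertex `x` the direction `w` is obtained from the direction `v` by reflection in the
tangent plane of the confocal ellipsoid through `x`. -/
def ReflectsInEllipsoid (a : Fin 3 → ℝ) (x v w : E3) : Prop :=
  ∃ u : ℝ, u < a 2 ∧ x ∈ quadric a u ∧
    w = (Submodule.span ℝ {normal a u x})ᗮ.reflection v

/-- The meeting parameters that are vertices of threads: the direction of the thread is reflected
in the confocal ellipsoid through the meeting point. -/
def vertexSet (a : Fin 3 → ℝ) (γ₁ γ₂ : ℝ → E3) (I₁ I₂ : Set ℝ) : Set (ℝ × ℝ × ℝ × ℝ) :=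
  {p | p ∈ meetSet γ₁ γ₂ I₁ I₂ ∧
    ReflectsInEllipsoid a (meetPoint γ₁ p) (deriv γ₁ p.1) (deriv γ₂ p.2.2.1)}

/-- The length of the thread that runs from `γ₁ α` along `γ₁` to `γ₁ s`, along the tangent to the
vertex, along a tangent of `γ₂` to `γ₂ r`, and along `γ₂` to `γ₂ β`. A geodesic arc that is run
through backwards (which happens if `s < α` or `β < r`) is counted negatively. -/
noncomputable def threadLength (γ₁ γ₂ : ℝ → E3) (α β : ℝ) (p : ℝ × ℝ × ℝ × ℝ) : ℝ :=
  (∫ x in α..p.1, ‖deriv γ₁ x‖) + dist (γ₁ p.1) (meetPoint γ₁ p)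
    + dist (meetPoint γ₁ p) (γ₂ p.2.2.1) + ∫ x in p.2.2.1..β, ‖deriv γ₂ x‖

end Confocal

/-!
Everything rests on the linear algebra of the forms `bil a u x y = ∑ⱼ xⱼ yⱼ / (aⱼ - u)`, which
satisfy the resolvent identity `mul_inner_normal_normal`.

*The directions at a meeting point.* Let `P` be a point of a tangent of the ellipsoid `u₃`, other
than the point of contact. It lies on a confocal ellipsoid of parameter `l < u₃`. If the tangent has
the unit direction `v` and touches the quadric `u₂` too, then
`∏ⱼ (aⱼ - u) * ((bil P v)² - Q P * bil v v) = (u - u₂) (u - u₃)` for all `u`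
(`IsTangentLine.discriminant_eq`), so `v` is determined up to the signs of its components along the
confocal normals at `P`. The sign along the normal of the ellipsoid `l` is different for the forward
and the backward tangent, because both leave that ellipsoid at `P` when they run away from their
points of contact. Another sign can change only where its component vanishes, that is on the quadric
`u₂`. So outside of that quadric, the meetings near a vertex are vertices
(`ThreadSetup.eventually_mem_vertexSet`). The argument uses the vector `tangentNormal a u₂ P v`,
the normal of the tangent plane of the quadric `u₂` along the line, in place of the normals of the
other two quadrics through `P`, so that no confocal coordinates are needed and points of the
coordinate planes are not exceptional.

*The curve of vertices.* The tangent plane of the tangent surface of a geodesic along the tangent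
with direction `v` is spanned by `v` and the normal of the ellipsoid `u₃`, and its normal is
`tangentNormal a u₂ P v` (Chasles, `IsTangentLine.inner_normal_tangentNormal`). This vector is not
orthogonal to the normal `n` of the ellipsoid `l` at `P` unless `Q a u₂ P = 0`. Therefore the two
surfaces are transversal at a vertex outside of the quadric `u₂`, and the implicit function theorem
applies (`ThreadSetup.exists_curve`). The reflection in `n` exchanges the two tangent planes, so
their intersection, the tangent of the curve, is orthogonal to `n`: the parameter `l` is stationary.
The derivative of the length of the thread is the product of the velocity with the difference of the
two directions, a multiple of `n`, so it vanishes too (`ThreadSetup.exists_locally_const`).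

*Connected sets of vertices.* At a vertex on the quadric `u₂` the surfaces touch each other and
the implicit function theorem does not apply. But such vertices are the intersections of the two
curves of points of contact with the quadric, which cross transversally, so they are isolated
(`ThreadSetup.eventually_ne_of_Q_eq_zero`) and countable in number. A continuous function that is
locally constant elsewhere takes only countably many values, hence is constant on connected sets
(`eq_of_isPreconnected_of_countable`).
-/

open Set Topology

namespace Confocal

/-! ### Linear algebra of a confocal family and of its common tangents -/

/-- The symmetric bilinear form `∑ⱼ xⱼ yⱼ / (aⱼ - u)` of the confocal quadric with parameter `u`. -/
noncomputable def bil (a : Fin 3 → ℝ) (u : ℝ) (x y : E3) : ℝ :=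
  ∑ j, x j * y j / (a j - u)

section Algebra

variable {a : Fin 3 → ℝ} {u w : ℝ}

lemma bil_comm (x y : E3) : bil a u x y = bil a u y x := by
  simp only [bil, mul_comm]

lemma bil_add_left (x y z : E3) : bil a u (x + y) z = bil a u x z + bil a u y z := by
  simp only [bil, Fin.sum_univ_three, PiLp.add_apply]; ring

lemma bil_smul_left (c : ℝ) (x z : E3) : bil a u (c • x) z = c * bil a u x z := by
  simp only [bil, Fin.sum_univ_three, PiLp.smul_apply, smul_eq_mul]; ring

lemma bil_add_right (x y z : E3) : bil a u z (x + y) = bil a u z x + bil a u z y := by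
  simp only [bil, Fin.sum_univ_three, PiLp.add_apply]; ring

lemma bil_sub_right (x y z : E3) : bil a u z (x - y) = bil a u z x - bil a u z y := by
  simp only [bil, Fin.sum_univ_three, PiLp.sub_apply]; ring

lemma bil_smul_right (c : ℝ) (x z : E3) : bil a u z (c • x) = c * bil a u z x := by
  simp only [bil, Fin.sum_univ_three, PiLp.smul_apply, smul_eq_mul]; ring

lemma Q_eq_bil (x : E3) : Q a u x = bil a u x x - 1 := by
  simp only [Q, bil, pow_two]

lemma inner_normal_left (x y : E3) : inner ℝ (normal a u x) y = bil a u x y := by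
  simp only [normal, bil, PiLp.inner_apply, Fin.sum_univ_three, RCLike.inner_apply, conj_trivial]
  ring

lemma inner_normal_right (x y : E3) : inner ℝ y (normal a u x) = bil a u x y := by
  rw [real_inner_comm, inner_normal_left]

lemma normal_add (x y : E3) : normal a u (x + y) = normal a u x + normal a u y := by
  ext j; simp [normal, add_div]

lemma normal_sub (x y : E3) : normal a u (x - y) = normal a u x - normal a u y := by
  ext j; simp [normal, sub_div]

lemma normal_smul (c : ℝ) (x : E3) : normal a u (c • x) = c • normal a u x := by
  ext j; simp [normal, mul_div_assoc]

/-- The resolvent identity `(A - u)⁻¹ - (A - w)⁻¹ = (u - w) (A - u)⁻¹ (A - w)⁻¹` for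
`A = diag a`. -/
lemma smul_normal_normal (hu : ∀ j, a j - u ≠ 0) (hw : ∀ j, a j - w ≠ 0) (x : E3) :
    (u - w) • normal a u (normal a w x) = normal a u x - normal a w x := by
  ext j
  have h1 := hu j
  have h2 := hw j
  simp only [normal, PiLp.smul_apply, PiLp.sub_apply, smul_eq_mul]
  field_simp
  ring

/-- The resolvent identity, paired with a vector. It gives the orthogonality of the normals of two
distinct confocal quadrics at a common point, and its generalizations by Chasles. -/
lemma mul_inner_normal_normal (hu : ∀ j, a j - u ≠ 0) (hw : ∀ j, a j - w ≠ 0) (x y : E3) :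
    (u - w) * inner ℝ (normal a u x) (normal a w y) = bil a u x y - bil a w x y := by
  rw [inner_normal_left, ← bil_smul_right, ← inner_normal_left, ← inner_normal_left,
    ← inner_normal_left]
  have key : inner ℝ (normal a u x) ((u - w) • normal a w y)
      = inner ℝ x ((u - w) • normal a u (normal a w y)) := by
    rw [inner_normal_left, real_inner_comm, inner_smul_left, inner_normal_left, bil_smul_right,
      bil_comm]
    simp
  rw [key, smul_normal_normal hu hw, inner_sub_right, inner_normal_right, inner_normal_right,
    inner_normal_left, inner_normal_left, bil_comm, bil_comm y x]

lemma normal_eq_zero (hu : ∀ j, a j - u ≠ 0) {x : E3} (h : normal a u x = 0) : x = 0 := by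
  ext j
  have h1 : x j / (a j - u) = 0 := by
    simpa [normal] using congrArg (fun z : E3 => z j) h
  simpa [hu j] using h1

lemma normal_ne_zero_of_Q (x : E3) (h : Q a u x = 0) : normal a u x ≠ 0 := by
  intro h0
  have := inner_normal_left (a := a) (u := u) x x
  rw [h0, inner_zero_left] at this
  rw [Q_eq_bil] at h
  linarith

lemma bil_self_pos (hu : ∀ j, u < a j) {x : E3} (hx : x ≠ 0) : 0 < bil a u x x := by
  obtain ⟨j, hj⟩ : ∃ j, x j ≠ 0 := by
    by_contra! h
    exact hx (by ext j; simpa using h j)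
  refine Finset.sum_pos' (fun i _ => ?_) ⟨j, Finset.mem_univ j, ?_⟩
  · exact div_nonneg (mul_self_nonneg _) (sub_pos.2 (hu i)).le
  · exact div_pos (mul_self_pos.2 hj) (sub_pos.2 (hu j))

/-- The forms of the confocal ellipsoids increase with the parameter. -/
lemma bil_self_lt (hw : ∀ j, w < a j) (huw : u < w) {x : E3} (hx : x ≠ 0) :
    bil a u x x < bil a w x x := by
  have hu : ∀ j, u < a j := fun j => huw.trans (hw j)
  have h := mul_inner_normal_normal (fun j => (sub_pos.2 (hw j)).ne')
    (fun j => (sub_pos.2 (hu j)).ne') x x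
  have h2 : 0 < inner ℝ (normal a w x) (normal a u x) := by
    obtain ⟨j, hj⟩ : ∃ j, x j ≠ 0 := by
      by_contra! h
      exact hx (by ext j; simpa using h j)
    rw [inner_normal_left]
    refine Finset.sum_pos' (fun i _ => ?_) ⟨j, Finset.mem_univ j, ?_⟩
    · simp only [normal, ← mul_div_assoc]
      exact div_nonneg (div_nonneg (mul_self_nonneg _) (sub_pos.2 (hu i)).le)
        (sub_pos.2 (hw i)).le
    · simp only [normal, ← mul_div_assoc]
      exact div_pos (div_pos (mul_self_pos.2 hj) (sub_pos.2 (hu j))) (sub_pos.2 (hw j))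
  have := mul_pos (sub_pos.2 huw) h2
  linarith

/-- In particular, a point lies on at most one confocal ellipsoid, and inside of the ellipsoids with
a smaller parameter. -/
lemma Q_lt_of_lt (hw : ∀ j, w < a j) (huw : u < w) {x : E3} (hx : x ≠ 0) :
    Q a u x < Q a w x := by
  rw [Q_eq_bil, Q_eq_bil]; linarith [bil_self_lt hw huw hx]

lemma ne_zero_of_Q {x : E3} (h : Q a u x = 0) : x ≠ 0 := by
  rintro rfl
  simp [Q] at h

/-- Through each point outside a confocal ellipsoid passes a confocal ellipsoid of smaller
parameter. -/
lemma exists_Q_eq_zero (hw : ∀ j, w < a j) {x : E3} (hx : 0 < Q a w x) :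
    ∃ l < w, Q a l x = 0 := by
  set N := w - ‖x‖ ^ 2 - 1 with hN
  have hNw : N < w := by nlinarith [sq_nonneg ‖x‖]
  have hN' : Q a N x < 0 := by
    have h1 : ∀ j, x j ^ 2 / (a j - N) ≤ x j ^ 2 / (‖x‖ ^ 2 + 1) := by
      intro j
      have := hw j
      gcongr
      linarith
    have h2 : ∑ j, x j ^ 2 / (a j - N) ≤ ∑ j, x j ^ 2 / (‖x‖ ^ 2 + 1) :=
      Finset.sum_le_sum fun j _ => h1 j
    rw [← Finset.sum_div, ← EuclideanSpace.real_norm_sq_eq] at h2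
    have h3 : ‖x‖ ^ 2 / (‖x‖ ^ 2 + 1) < 1 := by
      rw [div_lt_one (by positivity)]; linarith
    unfold Q
    linarith
  have hc : ContinuousOn (fun l => Q a l x) (Icc N w) := by
    unfold Q
    refine ContinuousOn.sub (continuousOn_finsetSum _ fun j _ => ?_) continuousOn_const
    refine ContinuousOn.div continuousOn_const (by fun_prop) fun l hl => ?_
    exact (sub_pos.2 (hl.2.trans_lt (hw j))).ne'
  obtain ⟨l, hl, h0⟩ := intermediate_value_Icc hNw.le hc ⟨hN'.le, hx.le⟩
  refine ⟨l, lt_of_le_of_ne hl.2 ?_, h0⟩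
  rintro rfl
  exact hx.ne' h0

end Algebra

/-- The line `{x + t v}` touches the confocal ellipsoid with parameter `u₃` at the point `x` and is
tangent to the confocal quadric with parameter `u₂`; the direction `v` is a unit vector. -/
structure IsTangentLine (a : Fin 3 → ℝ) (u₂ u₃ : ℝ) (x v : E3) : Prop where
  norm_eq_one : ‖v‖ = 1
  mem : Q a u₃ x = 0
  bil_eq_zero : bil a u₃ x v = 0
  tangent : bil a u₂ x v ^ 2 = bil a u₂ v v * Q a u₂ x

/-- The polar form of `v ↦ (bil P v)² - Q P * bil v v`, applied to `v`, as a vector. The zeros of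
this quadratic form are the directions of the tangents from `P` to the quadric with parameter `u`;
for such a direction, `tangentNormal a u P v` is normal to the tangent plane of the quadric along
the line `{P + t v}`, and it vanishes only if `P` is the point of contact. -/
noncomputable def tangentNormal (a : Fin 3 → ℝ) (u : ℝ) (P v : E3) : E3 :=
  bil a u P v • normal a u P - Q a u P • normal a u v

section Lines

variable {a : Fin 3 → ℝ} {u₂ u₃ l σ : ℝ} {x v P : E3}

lemma tangentNormal_sub (u : ℝ) (P v w : E3) :
    tangentNormal a u P (v - w) = tangentNormal a u P v - tangentNormal a u P w := by
  simp only [tangentNormal, bil_sub_right, normal_sub]; module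

lemma tangentNormal_smul (u c : ℝ) (P v : E3) :
    tangentNormal a u P (c • v) = c • tangentNormal a u P v := by
  simp only [tangentNormal, bil_smul_right, normal_smul]; module

lemma inner_tangentNormal (u : ℝ) (P v w : E3) :
    inner ℝ w (tangentNormal a u P v)
      = bil a u P v * bil a u P w - Q a u P * bil a u v w := by
  simp only [tangentNormal, inner_sub_right, inner_smul_right, inner_normal_right]

/-- The normal of a confocal quadric through `P` is a principal direction of the tangent cones from
`P` to all the confocal quadrics. -/
lemma tangentNormal_normal (h₂ : ∀ j, a j - u₂ ≠ 0) (hl : ∀ j, a j - l ≠ 0) (hu : u₂ ≠ l)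
    (hP : Q a l P = 0) :
    tangentNormal a u₂ P (normal a l P) = (Q a u₂ P / (u₂ - l)) • normal a l P := by
  have hne : u₂ - l ≠ 0 := sub_ne_zero.2 hu
  have h1 := mul_inner_normal_normal h₂ hl P P
  rw [inner_normal_left] at h1
  have h2 := smul_normal_normal h₂ hl P
  rw [Q_eq_bil] at hP
  have h3 : bil a u₂ P (normal a l P) = Q a u₂ P / (u₂ - l) := by
    rw [eq_div_iff hne, Q_eq_bil]; linarith
  have h4 : normal a u₂ (normal a l P) = (u₂ - l)⁻¹ • (normal a u₂ P - normal a l P) := by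
    rw [← h2, smul_smul, inv_mul_cancel₀ hne, one_smul]
  rw [tangentNormal, h3, h4, div_eq_mul_inv]
  module

namespace IsTangentLine

lemma inner_self (h : IsTangentLine a u₂ u₃ x v) : inner ℝ v v = 1 := by
  rw [real_inner_self_eq_norm_sq, h.norm_eq_one, one_pow]

lemma inner_normal (h : IsTangentLine a u₂ u₃ x v) : inner ℝ v (normal a u₃ x) = 0 := by
  rw [inner_normal_right, h.bil_eq_zero]

lemma ne_zero (h : IsTangentLine a u₂ u₃ x v) : v ≠ 0 := by
  rintro rfl
  simpa using h.norm_eq_one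

/-- The condition of tangency does not depend on the point chosen on the line. -/
lemma tangent_at (h : IsTangentLine a u₂ u₃ x v) :
    bil a u₂ (x + σ • v) v ^ 2 = bil a u₂ v v * Q a u₂ (x + σ • v) := by
  have := h.tangent
  simp only [Q_eq_bil, bil_add_left, bil_add_right, bil_smul_left, bil_smul_right,
    bil_comm v x] at *
  linear_combination this

lemma Q_point (h : IsTangentLine a u₂ u₃ x v) :
    Q a u₃ (x + σ • v) = σ ^ 2 * bil a u₃ v v := by
  have h1 := h.mem
  have h2 := h.bil_eq_zero
  simp only [Q_eq_bil, bil_add_left, bil_add_right, bil_smul_left, bil_smul_right,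
    bil_comm v x] at *
  linear_combination h1 + 2 * σ * h2

lemma inner_tangentNormal_self (h : IsTangentLine a u₂ u₃ x v) :
    inner ℝ v (tangentNormal a u₂ (x + σ • v) v) = 0 := by
  rw [inner_tangentNormal]; linear_combination h.tangent_at (σ := σ)

/-- Chasles: the tangent planes of two confocal quadrics along a common tangent line are
orthogonal. -/
lemma inner_normal_tangentNormal (h : IsTangentLine a u₂ u₃ x v) (h₂ : ∀ j, a j - u₂ ≠ 0)
    (h₃ : ∀ j, a j - u₃ ≠ 0) (hu : u₂ ≠ u₃) :
    inner ℝ (normal a u₃ x) (tangentNormal a u₂ (x + σ • v) v) = 0 := by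
  have hne : u₂ - u₃ ≠ 0 := sub_ne_zero.2 hu
  have h1 := mul_inner_normal_normal h₂ h₃ x x
  have h2 := mul_inner_normal_normal h₂ h₃ v x
  have t := h.tangent
  have m := h.mem
  have b := h.bil_eq_zero
  rw [inner_normal_left] at h1 h2
  rw [bil_comm v x, bil_comm v x] at h2
  apply mul_left_cancel₀ hne
  rw [inner_tangentNormal]
  simp only [Q_eq_bil, bil_add_left, bil_add_right, bil_smul_left, bil_smul_right,
    bil_comm v x] at *
  linear_combination (bil a u₂ x v + σ * bil a u₂ v v) * (h1 + σ * h2)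
    - (bil a u₂ x x - 1 + 2 * σ * bil a u₂ x v + σ ^ 2 * bil a u₂ v v) * h2
    - (bil a u₂ x v + σ * bil a u₂ v v) * (m + σ * b)
    + (bil a u₂ x x - 1 + 2 * σ * bil a u₂ x v + σ ^ 2 * bil a u₂ v v) * b - σ * t

/-- A point of a tangent other than the point of contact lies outside of the ellipsoid. -/
lemma lt_of_Q (h : IsTangentLine a u₂ u₃ x v) (h₃ : ∀ j, u₃ < a j) (hl : ∀ j, l < a j)
    (hσ : σ ≠ 0) (hP : Q a l (x + σ • v) = 0) : l < u₃ := by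
  by_contra! hle
  have h1 : 0 < Q a u₃ (x + σ • v) := by
    rw [h.Q_point]
    have := bil_self_pos h₃ h.ne_zero
    positivity
  rcases hle.eq_or_lt with rfl | hlt
  · exact h1.ne' hP
  · have := Q_lt_of_lt hl hlt (ne_zero_of_Q hP)
    linarith

lemma exists_Q (h : IsTangentLine a u₂ u₃ x v) (h₃ : ∀ j, u₃ < a j) (hσ : σ ≠ 0) :
    ∃ l < u₃, Q a l (x + σ • v) = 0 := by
  refine exists_Q_eq_zero h₃ ?_
  rw [h.Q_point]
  have := bil_self_pos h₃ h.ne_zero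
  positivity

/-- The point of contact lies inside of the larger ellipsoid through `x + σ v`, so the line leaves
that ellipsoid at `x + σ v` when it runs away from the point of contact. -/
lemma mul_bil_pos (h : IsTangentLine a u₂ u₃ x v) (h₃ : ∀ j, u₃ < a j) (hl : l < u₃)
    (hP : Q a l (x + σ • v) = 0) : 0 < σ * bil a l (x + σ • v) v := by
  have h1 := Q_lt_of_lt h₃ hl (ne_zero_of_Q h.mem)
  have h2 := h.mem
  have h3 := bil_self_pos (fun j => hl.trans (h₃ j)) h.ne_zero
  have h4 : 0 ≤ σ ^ 2 * bil a l v v := by positivity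
  simp only [Q_eq_bil, bil_add_left, bil_add_right, bil_smul_left, bil_smul_right,
    bil_comm v x] at *
  nlinarith

lemma inner_normal_normal (h : IsTangentLine a u₂ u₃ x v) (h₃ : ∀ j, a j - u₃ ≠ 0)
    (hl : ∀ j, a j - l ≠ 0) (hP : Q a l (x + σ • v) = 0) :
    (u₃ - l) * inner ℝ (normal a u₃ x) (normal a l (x + σ • v))
      = σ * bil a l (x + σ • v) v := by
  rw [mul_inner_normal_normal h₃ hl]
  have h2 := h.mem
  have h3 := h.bil_eq_zero
  simp only [Q_eq_bil, bil_add_left, bil_add_right, bil_smul_left, bil_smul_right,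
    bil_comm v x] at *
  linear_combination h2 + σ * h3 - hP

lemma inner_normal_normal_ne_zero (h : IsTangentLine a u₂ u₃ x v) (h₃ : ∀ j, u₃ < a j)
    (hl : l < u₃) (hP : Q a l (x + σ • v) = 0) :
    inner ℝ (normal a u₃ x) (normal a l (x + σ • v)) ≠ 0 := by
  intro h0
  have h1 := h.inner_normal_normal (fun j => (sub_pos.2 (h₃ j)).ne')
    (fun j => (sub_pos.2 (hl.trans (h₃ j))).ne') hP
  have h2 := h.mul_bil_pos h₃ hl hP
  rw [h0, mul_zero] at h1
  linarith

/-- By the two tangencies, the quadratic polynomial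
`∏ⱼ (aⱼ - u) * ((bil P v)² - Q P * bil v v)` in `u` is `(u - u₂) (u - u₃)`. -/
lemma discriminant_eq (h : IsTangentLine a u₂ u₃ x v) (h₂ : ∀ j, a j - u₂ ≠ 0)
    (h₃ : ∀ j, a j - u₃ ≠ 0) (hl : ∀ j, a j - l ≠ 0) (hu : u₂ ≠ u₃) :
    (∏ j, (a j - l)) * (bil a l (x + σ • v) v ^ 2 - bil a l v v * Q a l (x + σ • v))
      = (l - u₂) * (l - u₃) := by
  set P := x + σ • v with hP
  obtain ⟨b, c, key⟩ : ∃ b c : ℝ, ∀ u, (∀ j, a j - u ≠ 0) →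
      (∏ j, (a j - u)) * (bil a u P v ^ 2 - bil a u v v * Q a u P) = u ^ 2 + b * u + c := by
    have hn := h.inner_self
    simp only [PiLp.inner_apply, Fin.sum_univ_three, RCLike.inner_apply, conj_trivial] at hn
    refine ⟨-(v 0 ^ 2 * (a 1 + a 2) + v 1 ^ 2 * (a 0 + a 2) + v 2 ^ 2 * (a 0 + a 1))
      + ((P 0 * v 1 - P 1 * v 0) ^ 2 + (P 0 * v 2 - P 2 * v 0) ^ 2
        + (P 1 * v 2 - P 2 * v 1) ^ 2),
      v 0 ^ 2 * (a 1 * a 2) + v 1 ^ 2 * (a 0 * a 2) + v 2 ^ 2 * (a 0 * a 1)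
      - ((P 0 * v 1 - P 1 * v 0) ^ 2 * a 2 + (P 0 * v 2 - P 2 * v 0) ^ 2 * a 1
        + (P 1 * v 2 - P 2 * v 1) ^ 2 * a 0), fun u hj => ?_⟩
    have e0 := hj 0
    have e1 := hj 1
    have e2 := hj 2
    simp only [bil, Q, Fin.sum_univ_three, Fin.prod_univ_three]
    field_simp
    linear_combination (a 0 - u) * (a 1 - u) * (a 2 - u) * u ^ 2 * hn
  have t₂ := key u₂ h₂
  have t₃ := key u₃ h₃
  rw [h.tangent_at, sub_self, mul_zero] at t₂
  have h5 : bil a u₃ P v ^ 2 - bil a u₃ v v * Q a u₃ P = 0 := by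
    rw [hP, h.Q_point, bil_add_left, bil_smul_left, h.bil_eq_zero]; ring
  rw [h5, mul_zero] at t₃
  rw [key l hl]
  have hb : b = -(u₂ + u₃) := by
    apply mul_left_cancel₀ (sub_ne_zero.2 hu)
    linear_combination t₃ - t₂
  subst hb
  linear_combination -t₃

end IsTangentLine

end Lines

/-! ### The two tangents at a meeting point -/

section Corner

variable {a : Fin 3 → ℝ} {u₂ u₃ l κ t q : ℝ} {x y v w P : E3}

/-- Three linearly independent vectors of space have no common nonzero orthogonal vector. -/
lemma eq_zero_of_inner_eq_zero {e₁ e₂ e₃ z : E3} (he : LinearIndependent ℝ ![e₁, e₂, e₃])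
    (h₁ : inner ℝ z e₁ = 0) (h₂ : inner ℝ z e₂ = 0) (h₃ : inner ℝ z e₃ = 0) : z = 0 := by
  have hspan := he.span_eq_top_of_card_eq_finrank' (by simp)
  have hz : z ∈ Submodule.span ℝ (Set.range ![e₁, e₂, e₃]) := hspan ▸ Submodule.mem_top
  have : ∀ y ∈ Submodule.span ℝ (Set.range ![e₁, e₂, e₃]), inner ℝ z y = 0 := by
    intro y hy
    induction hy using Submodule.span_induction with
    | mem y hy =>
      obtain ⟨i, rfl⟩ := hy
      fin_cases i <;> simpa
    | zero => simp
    | add y y' _ _ hy hy' => rw [inner_add_right, hy, hy', add_zero]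
    | smul c y _ hy => rw [inner_smul_right, hy, mul_zero]
  exact inner_self_eq_zero.1 (this z hz)

lemma linearIndependent_three {e₁ e₂ e₃ : E3}
    (h : ∀ α β γ : ℝ, α • e₁ + β • e₂ + γ • e₃ = 0 → α = 0 ∧ β = 0 ∧ γ = 0) :
    LinearIndependent ℝ ![e₁, e₂, e₃] := by
  rw [Fintype.linearIndependent_iff]
  intro g hg
  simp only [Fin.sum_univ_three, Matrix.cons_val] at hg
  obtain ⟨h1, h2, h3⟩ := h _ _ _ hg
  intro i
  fin_cases i <;> simpa

lemma reflection_eq (n v : E3) :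
    (Submodule.span ℝ {n})ᗮ.reflection v = v - (2 * inner ℝ n v / ‖n‖ ^ 2) • n := by
  rw [Submodule.reflection_orthogonal_apply, Submodule.reflection_singleton_apply]
  simp only [RCLike.ofReal_real_eq_id, id]
  module

/-- The forward tangent leaves the confocal ellipsoid through a meeting point at the same angle at
which the backward tangent enters it. -/
lemma bil_eq_neg_bil (hv : IsTangentLine a u₂ u₃ x v) (hw : IsTangentLine a u₂ u₃ y w)
    (hx : P = x + t • v) (hy : P = y + (-q) • w) (ht : 0 < t) (hq : 0 < q)
    (h₂ : ∀ j, a j - u₂ ≠ 0) (h₃ : ∀ j, u₃ < a j) (hu : u₂ ≠ u₃) (hl : l < u₃)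
    (hP : Q a l P = 0) : bil a l P w = -bil a l P v := by
  have h₃' : ∀ j, a j - u₃ ≠ 0 := fun j => (sub_pos.2 (h₃ j)).ne'
  have hl' : ∀ j, 0 < a j - l := fun j => sub_pos.2 (hl.trans (h₃ j))
  have dv := hv.discriminant_eq (σ := t) h₂ h₃' (fun j => (hl' j).ne') hu
  have dw := hw.discriminant_eq (σ := -q) h₂ h₃' (fun j => (hl' j).ne') hu
  have pv := hv.mul_bil_pos (σ := t) h₃ hl (hx ▸ hP)
  have pw := hw.mul_bil_pos (σ := -q) h₃ hl (hy ▸ hP)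
  rw [← hx] at dv pv
  rw [← hy] at dw pw
  have hprod : (∏ j, (a j - l)) ≠ 0 := (Finset.prod_pos fun j _ => hl' j).ne'
  rw [hP, mul_zero, sub_zero] at dv dw
  have hsq : bil a l P w ^ 2 = bil a l P v ^ 2 := mul_left_cancel₀ hprod (dw.trans dv.symm)
  have p1 : 0 < bil a l P v := pos_of_mul_pos_right pv ht.le
  rcases sq_eq_sq_iff_eq_or_eq_neg.1 hsq with h | h
  · rw [h] at pw
    nlinarith [mul_pos hq p1]
  · exact h

/-- At a meeting point, the two directions have equal components up to signs in the frame of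
confocal normals. They are reflections of each other as soon as their sum does not lie in a plane
spanned by the normal of the ellipsoid and a principal direction. -/
lemma eq_reflection_of_linearIndependent (hv : IsTangentLine a u₂ u₃ x v)
    (hw : IsTangentLine a u₂ u₃ y w)
    (hx : P = x + t • v) (hy : P = y + (-q) • w) (ht : 0 < t) (hq : 0 < q)
    (h₂ : ∀ j, a j - u₂ ≠ 0) (h₃ : ∀ j, u₃ < a j) (hu : u₃ < u₂) (hl : l < u₃)
    (hP : Q a l P = 0)
    (hli : LinearIndependent ℝ ![normal a l P, v + w, tangentNormal a u₂ P (v + w)]) :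
    w = (Submodule.span ℝ {normal a l P})ᗮ.reflection v := by
  have hb := bil_eq_neg_bil hv hw hx hy ht hq h₂ h₃ hu.ne' hl hP
  have hl' : ∀ j, a j - l ≠ 0 := fun j => (sub_pos.2 (hl.trans (h₃ j))).ne'
  have hn : ‖normal a l P‖ ^ 2 ≠ 0 := pow_ne_zero 2 (norm_ne_zero_iff.2 (normal_ne_zero_of_Q P hP))
  rw [reflection_eq, inner_normal_left]
  set k : ℝ := 2 * bil a l P v / ‖normal a l P‖ ^ 2 with hk
  have hkn : k * ‖normal a l P‖ ^ 2 = 2 * bil a l P v := div_mul_cancel₀ _ hn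
  have nvw : inner ℝ (normal a l P) (v + w) = 0 := by
    rw [inner_normal_left, bil_add_right, hb]; ring
  have tn : inner ℝ (normal a l P) (tangentNormal a u₂ P (v + w)) = 0 := by
    have h := congrArg (fun z => inner ℝ (v + w) z)
      (tangentNormal_normal h₂ hl' (hl.trans hu).ne' hP)
    simp only [inner_smul_right] at h
    rw [real_inner_comm (normal a l P) (v + w), nvw, mul_zero, inner_tangentNormal] at h
    rw [inner_tangentNormal, bil_comm (v + w)]
    linear_combination h
  have tv := hv.tangent_at (σ := t)
  have tw := hw.tangent_at (σ := -q)
  rw [← hx] at tv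
  rw [← hy] at tw
  have hz : v - w - k • normal a l P = 0 := by
    refine eq_zero_of_inner_eq_zero hli ?_ ?_ ?_
    · rw [inner_sub_left, inner_sub_left, inner_smul_left, real_inner_self_eq_norm_sq,
        inner_normal_right, inner_normal_right, hb]
      simp only [conj_trivial]
      linear_combination -hkn
    · rw [inner_sub_left, inner_smul_left, nvw, mul_zero, sub_zero, inner_sub_left,
        inner_add_right, inner_add_right, hv.inner_self, hw.inner_self, real_inner_comm]
      ring
    · rw [inner_sub_left, inner_smul_left, tn, mul_zero, sub_zero, inner_tangentNormal]
      simp only [bil_add_left, bil_add_right, bil_sub_right, bil_comm w v]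
      linear_combination tv - tw
  rw [sub_eq_zero] at hz
  rw [← hz]; abel

/-- The vector `tangentNormal a u₂ P v` is not tangent to the confocal ellipsoid through `P`, unless
`P` is the point of contact. -/
lemma inner_tangentNormal_normal (h₂ : ∀ j, a j - u₂ ≠ 0) (hl : ∀ j, a j - l ≠ 0) (hu : u₂ ≠ l)
    (hP : Q a l P = 0) :
    inner ℝ (normal a l P) (tangentNormal a u₂ P v) = Q a u₂ P / (u₂ - l) * bil a l P v := by
  have h := congrArg (fun z => inner ℝ v z) (tangentNormal_normal h₂ hl hu hP)
  simp only [inner_smul_right, inner_normal_right, inner_tangentNormal] at h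
  rw [inner_tangentNormal, bil_comm v, ← h]
  ring

/-- The tangential part of the direction at a vertex outside of the quadric `u₂` is not a principal
direction. -/
lemma linearIndependent_of_vertex (hv : IsTangentLine a u₂ u₃ x v)
    (hx : P = x + t • v) (ht : 0 < t)
    (h₂ : ∀ j, a j - u₂ ≠ 0) (h₃ : ∀ j, u₃ < a j) (hu : u₃ < u₂) (hl : l < u₃)
    (hP : Q a l P = 0) (hw : w = v - κ • normal a l P) (hQ : Q a u₂ P ≠ 0) :
    LinearIndependent ℝ ![normal a l P, v + w, tangentNormal a u₂ P (v + w)] := by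
  have h₃' : ∀ j, a j - u₃ ≠ 0 := fun j => (sub_pos.2 (h₃ j)).ne'
  have hl' : ∀ j, a j - l ≠ 0 := fun j => (sub_pos.2 (hl.trans (h₃ j))).ne'
  have hul : u₂ ≠ l := (hl.trans hu).ne'
  have hsum : v + w = (2 : ℝ) • v - κ • normal a l P := by rw [hw]; module
  have e1 := hv.inner_normal
  have e2 := hv.inner_normal_tangentNormal (σ := t) h₂ h₃' hu.ne'
  have e3 := hv.inner_normal_normal_ne_zero (σ := t) h₃ hl (hx ▸ hP)
  have e4 := hv.inner_tangentNormal_self (σ := t)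
  have e5 := hv.mul_bil_pos (σ := t) h₃ hl (hx ▸ hP)
  rw [← hx] at e2 e3 e4 e5
  have e5' : bil a l P v ≠ 0 := (pos_of_mul_pos_right e5 ht.le).ne'
  refine linearIndependent_three fun α β γ h => ?_
  rw [hsum, tangentNormal_sub, tangentNormal_smul, tangentNormal_smul,
    tangentNormal_normal h₂ hl' hul hP] at h
  set c := α - β * κ - γ * κ * (Q a u₂ P / (u₂ - l)) with hc
  have h' : c • normal a l P + (2 * β) • v + (2 * γ) • tangentNormal a u₂ P v = 0 := by
    rw [← h, hc]; module
  have i1 := congrArg (fun z => inner ℝ (normal a u₃ x) z) h'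
  simp only [inner_add_right, inner_smul_right, inner_zero_right, e2] at i1
  rw [real_inner_comm v (normal a u₃ x), e1] at i1
  have hc0 : c = 0 := by
    have : c * inner ℝ (normal a u₃ x) (normal a l P) = 0 := by linarith
    exact (mul_eq_zero.1 this).resolve_right e3
  rw [hc0, zero_smul, zero_add] at h'
  have i2 := congrArg (fun z => inner ℝ v z) h'
  simp only [inner_add_right, inner_smul_right, inner_zero_right, e4, hv.inner_self] at i2
  have hβ : β = 0 := by linarith
  rw [hβ, mul_zero, zero_smul, zero_add] at h'
  have i3 := congrArg (fun z => inner ℝ (normal a l P) z) h'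
  simp only [inner_smul_right, inner_zero_right] at i3
  rw [inner_tangentNormal_normal h₂ hl' hul hP] at i3
  have hγ : γ = 0 := by
    have h0 : Q a u₂ P / (u₂ - l) * bil a l P v ≠ 0 :=
      mul_ne_zero (div_ne_zero hQ (sub_ne_zero.2 hul)) e5'
    have := (mul_eq_zero.1 i3).resolve_right h0
    linarith
  refine ⟨?_, hβ, hγ⟩
  rw [hβ, hγ] at hc
  linarith

lemma IsTangentLine.eq_zero_of_smul_add {α β : ℝ} (hv : IsTangentLine a u₂ u₃ x v)
    (h : α • v + β • normal a u₃ x = 0) : α = 0 ∧ β = 0 := by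
  have i := congrArg (fun z => inner ℝ v z) h
  simp only [inner_add_right, inner_smul_right, inner_zero_right, hv.inner_normal,
    hv.inner_self] at i
  have hα : α = 0 := by linarith
  rw [hα, zero_smul, zero_add] at h
  exact ⟨hα, (smul_eq_zero.1 h).resolve_right (normal_ne_zero_of_Q _ hv.mem)⟩

/-- At a vertex outside of the quadric `u₂`, the first tangent is transversal to the tangent plane of
the second tangent surface. -/
lemma eq_zero_of_smul_add_eq_zero (hv : IsTangentLine a u₂ u₃ x v) (hw : IsTangentLine a u₂ u₃ y w)
    (hx : P = x + t • v) (hy : P = y + (-q) • w) (ht : 0 < t)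
    (h₂ : ∀ j, a j - u₂ ≠ 0) (h₃ : ∀ j, u₃ < a j) (hu : u₃ < u₂) (hl : l < u₃)
    (hP : Q a l P = 0) (hκ : κ ≠ 0) (hwv : w = v - κ • normal a l P) (hQ : Q a u₂ P ≠ 0)
    {α β γ : ℝ} (h : α • v + β • w + γ • normal a u₃ y = 0) : α = 0 ∧ β = 0 ∧ γ = 0 := by
  have h₃' : ∀ j, a j - u₃ ≠ 0 := fun j => (sub_pos.2 (h₃ j)).ne'
  have hl' : ∀ j, a j - l ≠ 0 := fun j => (sub_pos.2 (hl.trans (h₃ j))).ne'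
  have hul : u₂ ≠ l := (hl.trans hu).ne'
  have f1 := hw.inner_normal_tangentNormal (σ := -q) h₂ h₃' hu.ne'
  have f2 := hw.inner_tangentNormal_self (σ := -q)
  have e5 := hv.mul_bil_pos (σ := t) h₃ hl (hx ▸ hP)
  rw [← hx] at e5
  rw [← hy] at f1 f2
  have e5' : bil a l P v ≠ 0 := (pos_of_mul_pos_right e5 ht.le).ne'
  have hvn : inner ℝ v (tangentNormal a u₂ P w) ≠ 0 := by
    have hvw : v = w + κ • normal a l P := by rw [hwv]; module
    have hb : inner ℝ v (tangentNormal a u₂ P w) = inner ℝ w (tangentNormal a u₂ P w)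
        + κ * inner ℝ (normal a l P) (tangentNormal a u₂ P w) := by
      conv_lhs => rw [hvw, inner_add_left, inner_smul_left]
      simp
    rw [hb, f2, zero_add, inner_tangentNormal_normal h₂ hl' hul hP]
    refine mul_ne_zero hκ (mul_ne_zero (div_ne_zero hQ (sub_ne_zero.2 hul)) ?_)
    have hself : inner ℝ v v = (1 : ℝ) := hv.inner_self
    have hw1 := hw.inner_self
    -- both directions are unit vectors, which determines `κ`
    rw [hwv] at hw1
    simp only [inner_sub_left, inner_sub_right, inner_smul_left, inner_smul_right, conj_trivial,
      hself, inner_normal_left, inner_normal_right] at hw1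
    have hk : κ * bil a l P (normal a l P) = 2 * bil a l P v := by
      apply mul_left_cancel₀ hκ
      linear_combination hw1
    rw [hwv, bil_sub_right, bil_smul_right, hk]
    intro h0
    apply e5'
    linarith
  have i1 := congrArg (fun z => inner ℝ z (tangentNormal a u₂ P w)) h
  simp only [inner_add_left, inner_smul_left, inner_zero_left, f1, f2, conj_trivial, mul_zero,
    add_zero] at i1
  have hα : α = 0 := (mul_eq_zero.1 i1).resolve_right hvn
  rw [hα, zero_smul, zero_add] at h
  exact ⟨hα, hw.eq_zero_of_smul_add h⟩

/-- A vector that is tangent to both tangent surfaces at a vertex outside of the quadric `u₂` is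
tangent to the confocal ellipsoid through the vertex. -/
lemma inner_normal_eq_zero_of_tangent (hv : IsTangentLine a u₂ u₃ x v)
    (hw : IsTangentLine a u₂ u₃ y w)
    (hx : P = x + t • v) (hy : P = y + (-q) • w)
    (h₂ : ∀ j, a j - u₂ ≠ 0) (h₃ : ∀ j, u₃ < a j) (hu : u₃ < u₂) (hl : l < u₃)
    (hP : Q a l P = 0) (hκ : κ ≠ 0) (hwv : w = v - κ • normal a l P) (hQ : Q a u₂ P ≠ 0)
    {α β α' β' : ℝ} {z : E3} (hz : z = α • v + β • normal a u₃ x)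
    (hz' : z = α' • w + β' • normal a u₃ y) : inner ℝ z (normal a l P) = 0 := by
  have h₃' : ∀ j, a j - u₃ ≠ 0 := fun j => (sub_pos.2 (h₃ j)).ne'
  have hl' : ∀ j, a j - l ≠ 0 := fun j => (sub_pos.2 (hl.trans (h₃ j))).ne'
  have hul : u₂ ≠ l := (hl.trans hu).ne'
  have e1 := hv.inner_normal_tangentNormal (σ := t) h₂ h₃' hu.ne'
  have e2 := hv.inner_tangentNormal_self (σ := t)
  have f1 := hw.inner_normal_tangentNormal (σ := -q) h₂ h₃' hu.ne'
  have f2 := hw.inner_tangentNormal_self (σ := -q)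
  rw [← hx] at e1 e2
  rw [← hy] at f1 f2
  have i1 : inner ℝ z (tangentNormal a u₂ P v) = 0 := by
    rw [hz, inner_add_left, inner_smul_left, inner_smul_left, e1, e2]; simp
  have i2 : inner ℝ z (tangentNormal a u₂ P w) = 0 := by
    rw [hz', inner_add_left, inner_smul_left, inner_smul_left, f1, f2]; simp
  rw [hwv, tangentNormal_sub, tangentNormal_smul, tangentNormal_normal h₂ hl' hul hP,
    inner_sub_right, i1, inner_smul_right, inner_smul_right] at i2
  have hne : κ * (Q a u₂ P / (u₂ - l)) ≠ 0 :=
    mul_ne_zero hκ (div_ne_zero hQ (sub_ne_zero.2 hul))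
  apply mul_left_cancel₀ hne
  linear_combination -i2

/-- Where a common tangent touches the quadric `u₂`, that quadric is tangent to the normal of the
ellipsoid at the other point of contact. -/
lemma IsTangentLine.bil_normal_eq_zero {σ : ℝ} (hv : IsTangentLine a u₂ u₃ x v)
    (h₂ : ∀ j, a j - u₂ ≠ 0) (h₃ : ∀ j, a j - u₃ ≠ 0) (hu : u₂ ≠ u₃)
    (hQ : Q a u₂ (x + σ • v) = 0) : bil a u₂ (x + σ • v) (normal a u₃ x) = 0 := by
  have tv := hv.tangent_at (σ := σ)
  rw [hQ, mul_zero, pow_eq_zero_iff two_ne_zero] at tv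
  have h1 := mul_inner_normal_normal h₂ h₃ (x + σ • v) x
  rw [inner_normal_left] at h1
  have hm := hv.mem
  have hb := hv.bil_eq_zero
  refine (mul_eq_zero.1 (h1.trans ?_)).resolve_left (sub_ne_zero.2 hu)
  simp only [Q_eq_bil, bil_add_left, bil_add_right, bil_smul_left, bil_smul_right,
    bil_comm v x] at *
  linear_combination hQ - σ * tv - hm - σ * hb

/-- The vertices on the quadric `u₂` are isolated: a vector that is tangent to both tangent surfaces
at such a vertex and conjugate to both directions vanishes, because the two directions span the
tangent plane of the quadric, whose second fundamental form is nondegenerate. -/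
lemma eq_zero_of_conjugate (hv : IsTangentLine a u₂ u₃ x v) (hw : IsTangentLine a u₂ u₃ y w)
    (hx : P = x + t • v) (hy : P = y + (-q) • w)
    (h₂ : ∀ j, a j - u₂ ≠ 0) (h₃ : ∀ j, u₃ < a j) (hu : u₃ < u₂) (hl : l < u₃)
    (hP : Q a l P = 0) (hκ : κ ≠ 0) (hwv : w = v - κ • normal a l P) (hQ : Q a u₂ P = 0)
    {α β : ℝ} {z : E3} (hz : z = α • v + β • normal a u₃ x)
    (hzv : bil a u₂ z v = 0) (hzw : bil a u₂ z w = 0) : z = 0 := by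
  have h₃' : ∀ j, a j - u₃ ≠ 0 := fun j => (sub_pos.2 (h₃ j)).ne'
  have hl' : ∀ j, a j - l ≠ 0 := fun j => (sub_pos.2 (hl.trans (h₃ j))).ne'
  have tv := hv.tangent_at (σ := t)
  have tw := hw.tangent_at (σ := -q)
  rw [← hx, hQ, mul_zero] at tv
  rw [← hy, hQ, mul_zero] at tw
  have tv0 : bil a u₂ P v = 0 := pow_eq_zero_iff two_ne_zero |>.1 tv
  have tw0 : bil a u₂ P w = 0 := pow_eq_zero_iff two_ne_zero |>.1 tw
  have hPP : bil a u₂ P P = 1 := by rw [Q_eq_bil] at hQ; linarith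
  have hνP := hv.bil_normal_eq_zero (σ := t) h₂ h₃' hu.ne' (hx ▸ hQ)
  rw [← hx] at hνP
  have hzP : bil a u₂ z P = 0 := by
    rw [bil_comm, hz, bil_add_right, bil_smul_right, bil_smul_right, tv0, hνP]; ring
  have hli : LinearIndependent ℝ ![v, w, P] := by
    refine linearIndependent_three fun α β γ h => ?_
    have i1 := congrArg (fun z => bil a u₂ P z) h
    simp only [bil_add_right, bil_smul_right, tv0, tw0, hPP] at i1
    have i1' : bil a u₂ P (0 : E3) = 0 := by simp [bil]
    rw [i1'] at i1
    have hγ : γ = 0 := by linarith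
    rw [hγ, zero_smul, add_zero, hwv] at h
    have h' : (α + β) • v = (β * κ) • normal a l P := by
      rw [← sub_eq_zero, ← h]; module
    have e3 := hv.inner_normal_normal_ne_zero (σ := t) h₃ hl (hx ▸ hP)
    rw [← hx] at e3
    have i2 := congrArg (fun z => inner ℝ (normal a u₃ x) z) h'
    simp only [inner_smul_right] at i2
    rw [real_inner_comm, hv.inner_normal, mul_zero] at i2
    have hβ : β = 0 := by
      have := (mul_eq_zero.1 i2.symm).resolve_right e3
      exact (mul_eq_zero.1 this).resolve_right hκ
    rw [hβ, zero_mul, zero_smul, add_zero] at h'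
    exact ⟨(smul_eq_zero.1 h').resolve_right hv.ne_zero, hβ, hγ⟩
  refine normal_eq_zero h₂ (eq_zero_of_inner_eq_zero hli ?_ ?_ ?_)
  all_goals rwa [inner_normal_left]

end Corner

/-! ### Calculus on the tangent surfaces -/

section Calculus

variable {a : Fin 3 → ℝ} {u u₂ u₃ : ℝ} {γ γ₁ γ₂ : ℝ → E3} {I I₁ I₂ : Set ℝ}

/-- `bil` as a continuous bilinear map. -/
noncomputable def bilL (a : Fin 3 → ℝ) (u : ℝ) : E3 →L[ℝ] E3 →L[ℝ] ℝ :=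
  (LinearMap.mk₂ ℝ (bil a u) bil_add_left bil_smul_left (fun z x y => bil_add_right x y z)
    (fun c z x => bil_smul_right c x z)).toContinuousBilinearMap

lemma bilL_apply (x y : E3) : bilL a u x y = bil a u x y := rfl

lemma hasFDerivAt_bil {E : Type*} [NormedAddCommGroup E] [NormedSpace ℝ E] {f g : E → E3}
    {f' g' : E →L[ℝ] E3} {p : E} (hf : HasFDerivAt f f' p) (hg : HasFDerivAt g g' p) :
    HasFDerivAt (fun p => bil a u (f p) (g p))
      ((bilL a u (f p)).comp g' + ((bilL a u).flip (g p)).comp f') p :=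
  (bilL a u).hasFDerivAt_of_bilinear hf hg

lemma hasDerivAt_bil {f g : ℝ → E3} {f' g' : E3} {s : ℝ} (hf : HasDerivAt f f' s)
    (hg : HasDerivAt g g' s) :
    HasDerivAt (fun s => bil a u (f s) (g s)) (bil a u (f s) g' + bil a u f' (g s)) s := by
  have := (hasFDerivAt_bil (a := a) (u := u) hf.hasFDerivAt hg.hasFDerivAt).hasDerivAt
  simpa [bilL_apply] using this

lemma continuousAt_bil {X : Type*} [TopologicalSpace X] {f g : X → E3} {p : X}
    (hf : ContinuousAt f p) (hg : ContinuousAt g p) :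
    ContinuousAt (fun p => bil a u (f p) (g p)) p := by
  simp only [← bilL_apply]
  fun_prop

/-- A curve that touches the ellipsoid with parameter `u₃`, with unit tangents that touch the
quadric with parameter `u₂`, and whose acceleration is a nonzero normal of the ellipsoid. -/
structure IsTangentFamily (a : Fin 3 → ℝ) (u₂ u₃ : ℝ) (γ : ℝ → E3) (I : Set ℝ) : Prop where
  isOpen : IsOpen I
  ordConnected : I.OrdConnected
  contDiffAt : ∀ s ∈ I, ContDiffAt ℝ 1 γ s
  contDiffAt_deriv : ∀ s ∈ I, ContDiffAt ℝ 1 (deriv γ) s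
  isTangentLine : ∀ s ∈ I, IsTangentLine a u₂ u₃ (γ s) (deriv γ s)
  acceleration : ∀ s ∈ I, ∃ k : ℝ, k ≠ 0 ∧ HasDerivAt (deriv γ) (k • normal a u₃ (γ s)) s

lemma IsTangentFamily.hasDerivAt (h : IsTangentFamily a u₂ u₃ γ I) {s : ℝ} (hs : s ∈ I) :
    HasDerivAt γ (deriv γ s) s :=
  ((h.contDiffAt s hs).differentiableAt one_ne_zero).hasDerivAt

/-- The acceleration of a geodesic of an ellipsoid does not vanish, because the second fundamental
form of the ellipsoid is definite. -/
lemma IsGeodesicOn.isTangentFamily (h : IsGeodesicOn a u₃ γ I) (ht : TangentsTangentTo a u₂ γ I)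
    (h₃ : ∀ j, u₃ < a j) : IsTangentFamily a u₂ u₃ γ I := by
  have hc : ∀ s ∈ I, ContDiffAt ℝ 2 γ s := fun s hs =>
    h.contDiffOn.contDiffAt (h.isOpen.mem_nhds hs)
  have hc' : ∀ s ∈ I, ContDiffAt ℝ 1 (deriv γ) s := fun s hs =>
    ((contDiffOn_succ_iff_deriv_of_isOpen (n := 1) h.isOpen).1
      (by simpa [one_add_one_eq_two] using h.contDiffOn)).2.2.contDiffAt (h.isOpen.mem_nhds hs)
  have hd : ∀ s ∈ I, HasDerivAt γ (deriv γ s) s := fun s hs =>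
    ((hc s hs).differentiableAt two_ne_zero).hasDerivAt
  have hd' : ∀ s ∈ I, HasDerivAt (deriv γ) (deriv (deriv γ) s) s := fun s hs =>
    ((hc' s hs).differentiableAt one_ne_zero).hasDerivAt
  have hmem : ∀ s ∈ I, bil a u₃ (γ s) (γ s) = 1 := by
    intro s hs
    have := h.mem_quadric s hs
    simp only [quadric, mem_ofPred_eq, Q_eq_bil] at this
    linarith
  have hb : ∀ s ∈ I, bil a u₃ (γ s) (deriv γ s) = 0 := by
    intro s hs
    have e1 := hasDerivAt_bil (a := a) (u := u₃) (hd s hs) (hd s hs)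
    have e2 : HasDerivAt (fun s => bil a u₃ (γ s) (γ s)) 0 s :=
      (hasDerivAt_const s (1 : ℝ)).congr_of_eventuallyEq
        (Filter.eventually_of_mem (h.isOpen.mem_nhds hs) hmem)
    have := e1.unique e2
    rw [bil_comm (deriv γ s)] at this
    linarith
  have hne : ∀ s ∈ I, deriv γ s ≠ 0 := by
    intro s hs h0
    have := h.unit_speed s hs
    simp [h0] at this
  refine ⟨h.isOpen, h.ordConnected, fun s hs => (hc s hs).of_le (by norm_num), hc',
    fun s hs => ⟨h.unit_speed s hs, h.mem_quadric s hs, hb s hs, ?_⟩, fun s hs => ?_⟩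
  · have := (ht s hs).2
    simpa only [bil, pow_two] using this
  · obtain ⟨k, hk⟩ := h.acceleration s hs
    refine ⟨k, ?_, hk ▸ hd' s hs⟩
    rintro rfl
    have e1 := hasDerivAt_bil (a := a) (u := u₃) (hd s hs) (hd' s hs)
    have e2 : HasDerivAt (fun s => bil a u₃ (γ s) (deriv γ s)) 0 s :=
      (hasDerivAt_const s (0 : ℝ)).congr_of_eventuallyEq
        (Filter.eventually_of_mem (h.isOpen.mem_nhds hs) hb)
    have := e1.unique e2
    rw [hk, bil_smul_right] at this
    have := bil_self_pos h₃ (hne s hs)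
    linarith

lemma hasFDerivAt_tangentPoint {E : Type*} [NormedAddCommGroup E] [NormedSpace ℝ E]
    {σ τ : E → ℝ} {σ' τ' : E →L[ℝ] ℝ} {p : E} {b : E3}
    (hγ : HasDerivAt γ (deriv γ (σ p)) (σ p)) (hγ' : HasDerivAt (deriv γ) b (σ p))
    (hσ : HasFDerivAt σ σ' p) (hτ : HasFDerivAt τ τ' p) :
    HasFDerivAt (fun p => tangentPoint γ (σ p) (τ p))
      (σ'.smulRight (deriv γ (σ p)) + (τ p • σ'.smulRight b + τ'.smulRight (deriv γ (σ p)))) p := by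
  have h1 : HasFDerivAt (fun p => γ (σ p)) (σ'.smulRight (deriv γ (σ p))) p := by
    refine (hγ.hasFDerivAt.comp p hσ).congr_fderiv ?_
    ext; simp
  have h2 : HasFDerivAt (fun p => deriv γ (σ p)) (σ'.smulRight b) p := by
    refine (hγ'.hasFDerivAt.comp p hσ).congr_fderiv ?_
    ext; simp
  exact h1.add (hτ.smul h2)

lemma hasDerivAt_tangentPoint {σ τ : ℝ → ℝ} {σ' τ' : ℝ} {s : ℝ} {b : E3}
    (hγ : HasDerivAt γ (deriv γ (σ s)) (σ s)) (hγ' : HasDerivAt (deriv γ) b (σ s))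
    (hσ : HasDerivAt σ σ' s) (hτ : HasDerivAt τ τ' s) :
    HasDerivAt (fun s => tangentPoint γ (σ s) (τ s))
      ((σ' + τ') • deriv γ (σ s) + (τ s * σ') • b) s := by
  have h := (hasFDerivAt_tangentPoint hγ hγ' hσ.hasFDerivAt hτ.hasFDerivAt).hasDerivAt
  refine h.congr_deriv ?_
  simp
  module

lemma contDiffAt_tangentPoint {E : Type*} [NormedAddCommGroup E] [NormedSpace ℝ E]
    {σ τ : E → ℝ} {p : E} (h : IsTangentFamily a u₂ u₃ γ I) (hp : σ p ∈ I)
    (hσ : ContDiffAt ℝ 1 σ p) (hτ : ContDiffAt ℝ 1 τ p) :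
    ContDiffAt ℝ 1 (fun p => tangentPoint γ (σ p) (τ p)) p :=
  ((h.contDiffAt _ hp).comp p hσ).add (hτ.smul ((h.contDiffAt_deriv _ hp).comp p hσ))

/-- The vector between the points of the two tangent surfaces with given parameters. -/
noncomputable def meetGap (γ₁ γ₂ : ℝ → E3) (p : ℝ × ℝ × ℝ × ℝ) : E3 :=
  tangentPoint γ₁ p.1 p.2.1 - tangentPoint γ₂ p.2.2.1 (-p.2.2.2)

lemma contDiffAt_meetGap (h₁ : IsTangentFamily a u₂ u₃ γ₁ I₁) (h₂ : IsTangentFamily a u₂ u₃ γ₂ I₂)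
    {p : ℝ × ℝ × ℝ × ℝ} (hp₁ : p.1 ∈ I₁) (hp₂ : p.2.2.1 ∈ I₂) :
    ContDiffAt ℝ 1 (meetGap γ₁ γ₂) p :=
  (contDiffAt_tangentPoint (σ := fun p : ℝ × ℝ × ℝ × ℝ => p.1) h₁ hp₁ (by fun_prop)
    (by fun_prop)).sub
    (contDiffAt_tangentPoint (σ := fun p : ℝ × ℝ × ℝ × ℝ => p.2.2.1) h₂ hp₂ (by fun_prop)
    (by fun_prop))

open ContinuousLinearMap in
lemma exists_hasFDerivAt_tangentPoint_left {p : ℝ × ℝ × ℝ × ℝ} {b : E3}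
    (hγ : HasDerivAt γ (deriv γ p.1) p.1) (hγ' : HasDerivAt (deriv γ) b p.1) :
    ∃ T : ℝ × ℝ × ℝ × ℝ →L[ℝ] E3,
      HasFDerivAt (fun p : ℝ × ℝ × ℝ × ℝ => tangentPoint γ p.1 p.2.1) T p ∧
      ∀ δ, T δ = (δ.1 + δ.2.1) • deriv γ p.1 + (p.2.1 * δ.1) • b := by
  have h1 : HasFDerivAt (fun p : ℝ × ℝ × ℝ × ℝ => p.2.1) _ p :=
    ((fst ℝ ℝ (ℝ × ℝ)).comp (snd ℝ ℝ (ℝ × ℝ × ℝ))).hasFDerivAt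
  refine ⟨_, hasFDerivAt_tangentPoint (σ := fun p : ℝ × ℝ × ℝ × ℝ => p.1) hγ hγ' hasFDerivAt_fst
    h1, fun δ => ?_⟩
  simp
  module

open ContinuousLinearMap in
lemma exists_hasFDerivAt_tangentPoint_right {p : ℝ × ℝ × ℝ × ℝ} {b : E3}
    (hγ : HasDerivAt γ (deriv γ p.2.2.1) p.2.2.1) (hγ' : HasDerivAt (deriv γ) b p.2.2.1) :
    ∃ T : ℝ × ℝ × ℝ × ℝ →L[ℝ] E3,
      HasFDerivAt (fun p : ℝ × ℝ × ℝ × ℝ => tangentPoint γ p.2.2.1 (-p.2.2.2)) T p ∧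
      ∀ δ, T δ = (δ.2.2.1 - δ.2.2.2) • deriv γ p.2.2.1 + (-p.2.2.2 * δ.2.2.1) • b := by
  have h1 : HasFDerivAt (fun p : ℝ × ℝ × ℝ × ℝ => p.2.2.1) _ p :=
    ((fst ℝ ℝ ℝ).comp ((snd ℝ ℝ (ℝ × ℝ)).comp (snd ℝ ℝ (ℝ × ℝ × ℝ)))).hasFDerivAt
  have h2 : HasFDerivAt (fun p : ℝ × ℝ × ℝ × ℝ => p.2.2.2) _ p :=
    ((snd ℝ ℝ ℝ).comp ((snd ℝ ℝ (ℝ × ℝ)).comp (snd ℝ ℝ (ℝ × ℝ × ℝ)))).hasFDerivAt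
  refine ⟨_, hasFDerivAt_tangentPoint (σ := fun p : ℝ × ℝ × ℝ × ℝ => p.2.2.1) hγ hγ' h1 h2.neg,
    fun δ => ?_⟩
  simp
  module

lemma meetPoint_eq {p : ℝ × ℝ × ℝ × ℝ} (hp : p ∈ meetSet γ₁ γ₂ I₁ I₂) :
    meetPoint γ₁ p = γ₂ p.2.2.1 + (-p.2.2.2) • deriv γ₂ p.2.2.1 := hp.2.2.2.2

/-- At a vertex, the two directions differ by a nonzero normal of a confocal ellipsoid that encloses
the ellipsoid `u₃`. -/
lemma exists_of_mem_vertexSet (h₁ : IsTangentFamily a u₂ u₃ γ₁ I₁) (h₃ : ∀ j, u₃ < a j)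
    (ha : ∀ j, a 2 ≤ a j)
    {p : ℝ × ℝ × ℝ × ℝ} (hp : p ∈ vertexSet a γ₁ γ₂ I₁ I₂) :
    ∃ l < u₃, Q a l (meetPoint γ₁ p) = 0 ∧ ∃ κ : ℝ, κ ≠ 0 ∧
      deriv γ₂ p.2.2.1 = deriv γ₁ p.1 - κ • normal a l (meetPoint γ₁ p) := by
  obtain ⟨hm, l, hl, hlP, hr⟩ := hp
  have hl' : ∀ j, l < a j := fun j => hl.trans_le (ha j)
  have hP : meetPoint γ₁ p = γ₁ p.1 + p.2.1 • deriv γ₁ p.1 := rfl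
  have hv := h₁.isTangentLine _ hm.1
  have hl₃ : l < u₃ := hv.lt_of_Q h₃ hl' hm.2.1.ne' (hP ▸ hlP)
  rw [reflection_eq] at hr
  refine ⟨l, hl₃, hlP, _, ?_, hr⟩
  have hpos := hv.mul_bil_pos (σ := p.2.1) h₃ hl₃ (hP ▸ hlP)
  rw [← hP] at hpos
  have := pos_of_mul_pos_right hpos hm.2.1.le
  have hn := norm_pos_iff.2 (normal_ne_zero_of_Q _ hlP)
  rw [inner_normal_left]
  positivity

end Calculus

/-! ### Meetings near a vertex -/

/-- Two curves as in the thread construction: both touch the ellipsoid with parameter `u₃`, and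
their tangents touch the quadric with parameter `u₂`. -/
structure ThreadSetup (a : Fin 3 → ℝ) (u₂ u₃ : ℝ) (γ₁ γ₂ : ℝ → E3) (I₁ I₂ : Set ℝ) : Prop where
  fst : IsTangentFamily a u₂ u₃ γ₁ I₁
  snd : IsTangentFamily a u₂ u₃ γ₂ I₂
  le : ∀ j, a 2 ≤ a j
  lt : ∀ j, u₃ < a j
  sub_ne_zero : ∀ j, a j - u₂ ≠ 0
  lt' : u₃ < u₂

namespace ThreadSetup

variable {a : Fin 3 → ℝ} {u₂ u₃ : ℝ} {γ₁ γ₂ : ℝ → E3} {I₁ I₂ : Set ℝ}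
  {p p₀ : ℝ × ℝ × ℝ × ℝ}

lemma meetGap_eq_zero (hp : p ∈ meetSet γ₁ γ₂ I₁ I₂) : meetGap γ₁ γ₂ p = 0 :=
  sub_eq_zero.2 hp.2.2.2.2

lemma exists_vertex (S : ThreadSetup a u₂ u₃ γ₁ γ₂ I₁ I₂) (hp : p ∈ vertexSet a γ₁ γ₂ I₁ I₂) :
    ∃ l < u₃, Q a l (meetPoint γ₁ p) = 0 ∧ ∃ κ : ℝ, κ ≠ 0 ∧
      deriv γ₂ p.2.2.1 = deriv γ₁ p.1 - κ • normal a l (meetPoint γ₁ p) :=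
  exists_of_mem_vertexSet S.fst S.lt S.le hp

/-- Near a vertex outside of the quadric `u₂`, the first parameter determines the meeting. -/
lemma exists_implicit (S : ThreadSetup a u₂ u₃ γ₁ γ₂ I₁ I₂)
    (hp : p₀ ∈ vertexSet a γ₁ γ₂ I₁ I₂) (hQ : Q a u₂ (meetPoint γ₁ p₀) ≠ 0) :
    ∃ c : ℝ → ℝ × ℝ × ℝ, ContDiffAt ℝ 1 c p₀.1 ∧ c p₀.1 = p₀.2 ∧
      ∀ᶠ p in 𝓝 p₀, meetGap γ₁ γ₂ p = 0 ↔ c p.1 = p.2 := by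
  obtain ⟨l, hl, hlP, κ, hκ, hw⟩ := S.exists_vertex hp
  obtain ⟨k₁, -, hd₁⟩ := S.fst.acceleration _ hp.1.1
  obtain ⟨k₂, hk₂, hd₂⟩ := S.snd.acceleration _ hp.1.2.2.1
  obtain ⟨T₁, hT₁, hT₁'⟩ := exists_hasFDerivAt_tangentPoint_left (p := p₀)
    (S.fst.hasDerivAt hp.1.1) hd₁
  obtain ⟨T₂, hT₂, hT₂'⟩ := exists_hasFDerivAt_tangentPoint_right (p := p₀)
    (S.snd.hasDerivAt hp.1.2.2.1) hd₂
  have hC := contDiffAt_meetGap S.fst S.snd hp.1.1 hp.1.2.2.1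
  have hF : fderiv ℝ (meetGap γ₁ γ₂) p₀ = T₁ - T₂ := (hT₁.sub hT₂).fderiv
  have hinv : (fderiv ℝ (meetGap γ₁ γ₂) p₀ ∘L .inr ℝ ℝ (ℝ × ℝ × ℝ)).IsInvertible := by
    have hinj : Function.Injective
        ((fderiv ℝ (meetGap γ₁ γ₂) p₀ ∘L .inr ℝ ℝ (ℝ × ℝ × ℝ)) : ℝ × ℝ × ℝ →ₗ[ℝ] E3) := by
      rw [← LinearMap.ker_eq_bot, LinearMap.ker_eq_bot']
      rintro ⟨dt, dr, dq⟩ h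
      simp only [ContinuousLinearMap.coe_coe, ContinuousLinearMap.comp_apply, hF,
        ContinuousLinearMap.inr_apply, sub_apply, hT₁', hT₂'] at h
      have h' : dt • deriv γ₁ p₀.1 + (dq - dr) • deriv γ₂ p₀.2.2.1
          + (p₀.2.2.2 * dr * k₂) • normal a u₃ (γ₂ p₀.2.2.1) = 0 := by
        rw [← h]; module
      obtain ⟨h1, h2, h3⟩ := eq_zero_of_smul_add_eq_zero (S.fst.isTangentLine _ hp.1.1)
        (S.snd.isTangentLine _ hp.1.2.2.1) rfl (meetPoint_eq hp.1) hp.1.2.1 S.sub_ne_zero S.lt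
        S.lt' hl hlP hκ hw hQ h'
      have hdr : dr = 0 := by
        rcases mul_eq_zero.1 h3 with h | h
        · exact (mul_eq_zero.1 h).resolve_left hp.1.2.2.2.1.ne'
        · exact absurd h hk₂
      have hdq : dq = 0 := by linarith
      rw [h1, hdr, hdq]; rfl
    refine ⟨(LinearMap.linearEquivOfInjective _ hinj (by simp)).toContinuousLinearEquiv, ?_⟩
    exact ContinuousLinearMap.ext fun _ => rfl
  refine ⟨hC.implicitFunction one_ne_zero hinv, hC.contDiffAt_implicitFunction one_ne_zero hinv,
    hC.implicitFunction_apply_self one_ne_zero hinv, ?_⟩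
  have := hC.eventually_apply_eq_iff_implicitFunction one_ne_zero hinv
  rwa [meetGap_eq_zero hp.1] at this

/-- The parameter of the confocal ellipsoid through a point depends continuously on the point. -/
lemma eventually_of_Q {l : ℝ} (hu : ∀ j, u₃ < a j) (hl : l < u₃) {P : E3} (hP : Q a l P = 0)
    {s : Set ℝ} (hs : s ∈ 𝓝 l) : ∀ᶠ x in 𝓝 P, ∀ m < u₃, Q a m x = 0 → m ∈ s := by
  obtain ⟨l₁, l₂, ⟨h1, h2⟩, hsub⟩ := mem_nhds_iff_exists_Ioo_subset.1
    (Filter.inter_mem hs (Iio_mem_nhds hl))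
  obtain ⟨b₁, hb₁, hb₁'⟩ := exists_between h1
  obtain ⟨b₂, hb₂, hb₂'⟩ := exists_between h2
  have hb₂u : b₂ < u₃ := (hsub ⟨h1.trans hb₂, hb₂'⟩).2
  have hc : ∀ m, Continuous fun x => Q a m x := fun m => by unfold Q; fun_prop
  have e1 : ∀ᶠ x in 𝓝 P, Q a b₁ x < 0 := (hc b₁).continuousAt.eventually_lt_const
    (hP ▸ Q_lt_of_lt (fun j => hl.trans (hu j)) hb₁' (ne_zero_of_Q hP))
  have e2 : ∀ᶠ x in 𝓝 P, 0 < Q a b₂ x := (hc b₂).continuousAt.eventually_const_lt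
    (hP ▸ Q_lt_of_lt (fun j => hb₂u.trans (hu j)) hb₂ (ne_zero_of_Q hP))
  filter_upwards [e1, e2] with x hx1 hx2 m hm hmx
  have hx0 := ne_zero_of_Q hmx
  refine (hsub ⟨hb₁.trans ?_, lt_trans ?_ hb₂'⟩).1
  · by_contra! h
    rcases h.eq_or_lt with rfl | h
    · exact hx1.ne hmx
    · linarith [Q_lt_of_lt (fun j => (hb₁'.trans hl).trans (hu j)) h hx0]
  · by_contra! h
    rcases h.eq_or_lt with rfl | h
    · exact hx2.ne' hmx
    · linarith [Q_lt_of_lt (fun j => hm.trans (hu j)) h hx0]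

lemma continuousAt_normal {X : Type*} [TopologicalSpace X] {f : X → ℝ} {g : X → E3} {z : X}
    (hf : ContinuousAt f z) (hg : ContinuousAt g z) (h : ∀ j, a j - f z ≠ 0) :
    ContinuousAt (fun z => normal a (f z) (g z)) z := by
  refine (PiLp.continuous_toLp 2 _).continuousAt.comp (continuousAt_pi.2 fun j => ?_)
  refine ContinuousAt.div ?_ (continuousAt_const.sub hf) (h j)
  exact (EuclideanSpace.proj j : E3 →L[ℝ] ℝ).continuous.continuousAt.comp hg

lemma continuousAt_meetPoint (S : ThreadSetup a u₂ u₃ γ₁ γ₂ I₁ I₂) (hp : p.1 ∈ I₁) :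
    ContinuousAt (meetPoint γ₁) p :=
  (contDiffAt_tangentPoint (σ := fun p : ℝ × ℝ × ℝ × ℝ => p.1) S.fst hp (by fun_prop)
    (by fun_prop)).continuousAt

lemma continuousAt_deriv_fst (S : ThreadSetup a u₂ u₃ γ₁ γ₂ I₁ I₂) (hp : p.1 ∈ I₁) :
    ContinuousAt (fun p : ℝ × ℝ × ℝ × ℝ => deriv γ₁ p.1) p :=
  (S.fst.contDiffAt_deriv _ hp).continuousAt.comp (f := fun p : ℝ × ℝ × ℝ × ℝ => p.1)
    continuousAt_fst

lemma continuousAt_deriv_snd (S : ThreadSetup a u₂ u₃ γ₁ γ₂ I₁ I₂) (hp : p.2.2.1 ∈ I₂) :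
    ContinuousAt (fun p : ℝ × ℝ × ℝ × ℝ => deriv γ₂ p.2.2.1) p :=
  (S.snd.contDiffAt_deriv _ hp).continuousAt.comp (f := fun p : ℝ × ℝ × ℝ × ℝ => p.2.2.1)
    (by fun_prop)

/-- Outside of the quadric `u₂` the signs of the components of a common tangent direction in the
frame of confocal normals cannot change, so the meetings near a vertex are vertices. -/
lemma eventually_mem_vertexSet (S : ThreadSetup a u₂ u₃ γ₁ γ₂ I₁ I₂)
    (hp : p₀ ∈ vertexSet a γ₁ γ₂ I₁ I₂) (hQ : Q a u₂ (meetPoint γ₁ p₀) ≠ 0) :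
    ∀ᶠ p in 𝓝 p₀, p ∈ meetSet γ₁ γ₂ I₁ I₂ → p ∈ vertexSet a γ₁ γ₂ I₁ I₂ := by
  obtain ⟨l, hl, hlP, κ, hκ, hw⟩ := S.exists_vertex hp
  have hli := linearIndependent_of_vertex (S.fst.isTangentLine _ hp.1.1) rfl hp.1.2.1 S.sub_ne_zero
    S.lt S.lt' hl hlP hw hQ
  have hcP := S.continuousAt_meetPoint hp.1.1
  have hcv := (S.continuousAt_deriv_fst hp.1.1).add (S.continuousAt_deriv_snd hp.1.2.2.1)
  have hev : ∀ᶠ z : ℝ × ℝ × ℝ × ℝ × ℝ in 𝓝 (l, p₀), LinearIndependent ℝ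
      ![normal a z.1 (meetPoint γ₁ z.2), deriv γ₁ z.2.1 + deriv γ₂ z.2.2.2.1,
        tangentNormal a u₂ (meetPoint γ₁ z.2) (deriv γ₁ z.2.1 + deriv γ₂ z.2.2.2.1)] := by
    have hP' : ContinuousAt (fun z : ℝ × ℝ × ℝ × ℝ × ℝ => meetPoint γ₁ z.2) (l, p₀) :=
      ContinuousAt.comp (f := fun z : ℝ × ℝ × ℝ × ℝ × ℝ => z.2) (x := (l, p₀)) hcP continuousAt_snd
    have hv' : ContinuousAt (fun z : ℝ × ℝ × ℝ × ℝ × ℝ => deriv γ₁ z.2.1 + deriv γ₂ z.2.2.2.1)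
        (l, p₀) :=
      ContinuousAt.comp (f := fun z : ℝ × ℝ × ℝ × ℝ × ℝ => z.2) (x := (l, p₀)) hcv continuousAt_snd
    have hn' := continuousAt_normal (a := a) (z := (l, p₀)) continuousAt_fst hP'
      fun j => (sub_pos.2 (hl.trans (S.lt j))).ne'
    have hn₁ := continuousAt_normal (a := a) (z := (l, p₀)) (f := fun _ => u₂) continuousAt_const hP'
      S.sub_ne_zero
    have hn₂ := continuousAt_normal (a := a) (z := (l, p₀)) (f := fun _ => u₂) continuousAt_const hv'
      S.sub_ne_zero
    have ht' : ContinuousAt (fun z : ℝ × ℝ × ℝ × ℝ × ℝ => tangentNormal a u₂ (meetPoint γ₁ z.2)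
        (deriv γ₁ z.2.1 + deriv γ₂ z.2.2.2.1)) (l, p₀) := by
      simp only [tangentNormal, Q_eq_bil]
      exact ((continuousAt_bil hP' hv').smul hn₁).sub
        (((continuousAt_bil hP' hP').sub continuousAt_const).smul hn₂)
    have hc : ContinuousAt (fun z : ℝ × ℝ × ℝ × ℝ × ℝ => ![normal a z.1 (meetPoint γ₁ z.2),
        deriv γ₁ z.2.1 + deriv γ₂ z.2.2.2.1,
        tangentNormal a u₂ (meetPoint γ₁ z.2) (deriv γ₁ z.2.1 + deriv γ₂ z.2.2.2.1)]) (l, p₀) := by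
      refine continuousAt_pi.2 fun i => ?_
      fin_cases i
      exacts [hn', hv', ht']
    exact hc.eventually (isOpen_setOfPred_linearIndependent.mem_nhds hli)
  rw [nhds_prod_eq] at hev
  obtain ⟨A, hA, B, hB, hAB⟩ := Filter.eventually_prod_iff.1 hev
  filter_upwards [hB, hcP.eventually (eventually_of_Q S.lt hl hlP hA)] with p hpB hpA hpM
  have hv := S.fst.isTangentLine _ hpM.1
  obtain ⟨m, hm, hmP⟩ := hv.exists_Q S.lt hpM.2.1.ne'
  change Q a m (meetPoint γ₁ p) = 0 at hmP
  refine ⟨hpM, m, hm.trans (S.lt 2), hmP, ?_⟩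
  exact eq_reflection_of_linearIndependent hv (S.snd.isTangentLine _ hpM.2.2.1) rfl
    (meetPoint_eq hpM) hpM.2.1 hpM.2.2.2.1 S.sub_ne_zero S.lt S.lt' hm hmP
    (hAB (hpA m hm hmP) hpB)

/-- Near a vertex outside of the quadric `u₂`, the meetings form a curve of vertices that is
parametrized by the first parameter. -/
lemma exists_curve (S : ThreadSetup a u₂ u₃ γ₁ γ₂ I₁ I₂)
    (hp : p₀ ∈ vertexSet a γ₁ γ₂ I₁ I₂) (hQ : Q a u₂ (meetPoint γ₁ p₀) ≠ 0) :
    ∃ U ∈ 𝓝 p₀, ∃ ε > 0, ∃ c : ℝ → ℝ × ℝ × ℝ,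
      ContDiffOn ℝ 1 c (Ioo (p₀.1 - ε) (p₀.1 + ε)) ∧
      meetSet γ₁ γ₂ I₁ I₂ ∩ U = (fun s => (s, c s)) '' Ioo (p₀.1 - ε) (p₀.1 + ε) ∧
      meetSet γ₁ γ₂ I₁ I₂ ∩ U ⊆ vertexSet a γ₁ γ₂ I₁ I₂ ∧
      ∀ p ∈ meetSet γ₁ γ₂ I₁ I₂ ∩ U, Q a u₂ (meetPoint γ₁ p) ≠ 0 := by
  obtain ⟨c, hc, hc0, hiff⟩ := S.exists_implicit hp hQ
  have hcP := S.continuousAt_meetPoint hp.1.1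
  have hQc : Continuous fun x => Q a u₂ x := by unfold Q; fun_prop
  have e1 : ∀ᶠ p : ℝ × ℝ × ℝ × ℝ in 𝓝 p₀, p.1 ∈ I₁ :=
    continuousAt_fst.eventually (S.fst.isOpen.mem_nhds hp.1.1)
  have e2 : ∀ᶠ p : ℝ × ℝ × ℝ × ℝ in 𝓝 p₀, 0 < p.2.1 :=
    (by fun_prop : ContinuousAt (fun p : ℝ × ℝ × ℝ × ℝ => p.2.1) p₀).eventually_const_lt hp.1.2.1
  have e3 : ∀ᶠ p : ℝ × ℝ × ℝ × ℝ in 𝓝 p₀, p.2.2.1 ∈ I₂ :=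
    (by fun_prop : ContinuousAt (fun p : ℝ × ℝ × ℝ × ℝ => p.2.2.1) p₀).eventually
      (S.snd.isOpen.mem_nhds hp.1.2.2.1)
  have e4 : ∀ᶠ p : ℝ × ℝ × ℝ × ℝ in 𝓝 p₀, 0 < p.2.2.2 :=
    (by fun_prop : ContinuousAt (fun p : ℝ × ℝ × ℝ × ℝ => p.2.2.2) p₀).eventually_const_lt
      hp.1.2.2.2.1
  have e5 : ∀ᶠ p in 𝓝 p₀, Q a u₂ (meetPoint γ₁ p) ≠ 0 :=
    (hQc.continuousAt.comp hcP).eventually_ne hQ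
  obtain ⟨W, hW, hWp⟩ := Filter.eventually_iff_exists_mem.1 (hiff.and (e1.and (e2.and (e3.and
    (e4.and (e5.and (S.eventually_mem_vertexSet hp hQ)))))))
  have hgraph : ∀ᶠ s in 𝓝 p₀.1, (s, c s) ∈ W := by
    have hcont : ContinuousAt (fun s => (s, c s)) p₀.1 := continuousAt_id.prodMk hc.continuousAt
    have h0 : (p₀.1, c p₀.1) = p₀ := Prod.ext rfl hc0
    exact hcont.eventually (show W ∈ 𝓝 (p₀.1, c p₀.1) by rwa [h0])
  have hsmooth : ∀ᶠ s in 𝓝 p₀.1, ContDiffAt ℝ 1 c s := hc.eventually (by simp)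
  obtain ⟨ε, hε, hball⟩ := Metric.eventually_nhds_iff_ball.1 (hgraph.and hsmooth)
  rw [Real.ball_eq_Ioo] at hball
  refine ⟨W ∩ Prod.fst ⁻¹' Ioo (p₀.1 - ε) (p₀.1 + ε), Filter.inter_mem hW
    (continuousAt_fst.preimage_mem_nhds (Ioo_mem_nhds (by linarith) (by linarith))), ε, hε, c,
    fun s hs => (hball s hs).2.contDiffWithinAt, ?_, ?_, ?_⟩
  · ext p
    constructor
    · rintro ⟨hM, hpW, hps⟩
      exact ⟨p.1, hps, Prod.ext rfl ((hWp p hpW).1.1 (meetGap_eq_zero hM))⟩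
    · rintro ⟨s, hs, rfl⟩
      have hsW := (hball s hs).1
      obtain ⟨h0, h1, h2, h3, h4, -⟩ := hWp _ hsW
      exact ⟨⟨h1, h2, h3, h4, sub_eq_zero.1 (h0.2 rfl)⟩, hsW, hs⟩
  · rintro p ⟨hM, hpW, -⟩
    exact (hWp p hpW).2.2.2.2.2.2 hM
  · rintro p ⟨-, hpW, -⟩
    exact (hWp p hpW).2.2.2.2.2.1

/-- The velocity of the meeting point along a curve of meetings, computed on both tangent
surfaces. -/
lemma exists_hasDerivAt_meetPoint (S : ThreadSetup a u₂ u₃ γ₁ γ₂ I₁ I₂) {c : ℝ → ℝ × ℝ × ℝ}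
    {c' : ℝ × ℝ × ℝ} {s : ℝ} (hc : HasDerivAt c c' s)
    (hM : ∀ᶠ s' in 𝓝 s, (s', c s') ∈ meetSet γ₁ γ₂ I₁ I₂) :
    ∃ (z : E3) (k₁ k₂ : ℝ), k₁ ≠ 0 ∧
      HasDerivAt (fun s' => meetPoint γ₁ (s', c s')) z s ∧
      z = (1 + c'.1) • deriv γ₁ s + k₁ • normal a u₃ (γ₁ s) ∧
      z = (c'.2.1 - c'.2.2) • deriv γ₂ (c s).2.1 + k₂ • normal a u₃ (γ₂ (c s).2.1) := by
  have hs := hM.self_of_nhds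
  obtain ⟨k₁, hk₁, hd₁⟩ := S.fst.acceleration _ hs.1
  obtain ⟨k₂, -, hd₂⟩ := S.snd.acceleration _ hs.2.2.1
  have ht : HasDerivAt (fun s => (c s).1) c'.1 s := hc.fst
  have hr : HasDerivAt (fun s => (c s).2.1) c'.2.1 s := hc.snd.fst
  have hq : HasDerivAt (fun s => (c s).2.2) c'.2.2 s := hc.snd.snd
  have h₁ := hasDerivAt_tangentPoint (σ := fun s => s) (S.fst.hasDerivAt hs.1) hd₁
    (hasDerivAt_id' s) ht
  have h₂ := hasDerivAt_tangentPoint (σ := fun s => (c s).2.1) (S.snd.hasDerivAt hs.2.2.1) hd₂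
    hr hq.fun_neg
  have h₂' : HasDerivAt (fun s' => meetPoint γ₁ (s', c s')) _ s :=
    h₂.congr_of_eventuallyEq (hM.mono fun s' hs' => hs'.2.2.2.2)
  refine ⟨_, (c s).1 * k₁, -(c s).2.2 * c'.2.1 * k₂, mul_ne_zero hs.2.1.ne' hk₁, h₁, ?_, ?_⟩
  · module
  · rw [h₁.unique h₂']; module

/-- The vertices on the quadric `u₂` are isolated among each other. -/
lemma eventually_ne_of_Q_eq_zero (S : ThreadSetup a u₂ u₃ γ₁ γ₂ I₁ I₂)
    (hp : p₀ ∈ vertexSet a γ₁ γ₂ I₁ I₂) (hQ : Q a u₂ (meetPoint γ₁ p₀) = 0) :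
    ∀ᶠ p in 𝓝[≠] p₀, ¬ (p ∈ meetSet γ₁ γ₂ I₁ I₂ ∧ Q a u₂ (meetPoint γ₁ p) = 0) := by
  obtain ⟨l, hl, hlP, κ, hκ, hw⟩ := S.exists_vertex hp
  obtain ⟨k₁, hk₁, hd₁⟩ := S.fst.acceleration _ hp.1.1
  obtain ⟨k₂, hk₂, hd₂⟩ := S.snd.acceleration _ hp.1.2.2.1
  obtain ⟨T₁, hT₁, hT₁'⟩ := exists_hasFDerivAt_tangentPoint_left (p := p₀)
    (S.fst.hasDerivAt hp.1.1) hd₁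
  obtain ⟨T₂, hT₂, hT₂'⟩ := exists_hasFDerivAt_tangentPoint_right (p := p₀)
    (S.snd.hasDerivAt hp.1.2.2.1) hd₂
  have hv := S.fst.isTangentLine _ hp.1.1
  have hw' := S.snd.isTangentLine _ hp.1.2.2.1
  have hP₁ : meetPoint γ₁ p₀ = γ₁ p₀.1 + p₀.2.1 • deriv γ₁ p₀.1 := rfl
  have hP₂ := meetPoint_eq hp.1
  have hD₁ := hd₁.hasFDerivAt.comp p₀ (ContinuousLinearMap.fst ℝ ℝ (ℝ × ℝ × ℝ)).hasFDerivAt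
  have hD₂ := hd₂.hasFDerivAt.comp p₀ ((ContinuousLinearMap.fst ℝ ℝ ℝ).comp
    ((ContinuousLinearMap.snd ℝ ℝ (ℝ × ℝ)).comp
      (ContinuousLinearMap.snd ℝ ℝ (ℝ × ℝ × ℝ)))).hasFDerivAt
  have hB₁ := hasFDerivAt_bil (a := a) (u := u₂) hT₁ hD₁
  have hB₂ := hasFDerivAt_bil (a := a) (u := u₂) hT₁ hD₂
  -- the meetings at common points of contact are the common zeros of these five functions
  obtain ⟨T, hT, hTδ⟩ : ∃ T : ℝ × ℝ × ℝ × ℝ →L[ℝ] E3 × ℝ × ℝ,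
      HasFDerivAt (fun p => (meetGap γ₁ γ₂ p, bil a u₂ (meetPoint γ₁ p) (deriv γ₁ p.1),
        bil a u₂ (meetPoint γ₁ p) (deriv γ₂ p.2.2.1))) T p₀ ∧
      ∀ δ, T δ = (T₁ δ - T₂ δ,
        bil a u₂ (meetPoint γ₁ p₀) (δ.1 • k₁ • normal a u₃ (γ₁ p₀.1))
          + bil a u₂ (T₁ δ) (deriv γ₁ p₀.1),
        bil a u₂ (meetPoint γ₁ p₀) (δ.2.2.1 • k₂ • normal a u₃ (γ₂ p₀.2.2.1))
          + bil a u₂ (T₁ δ) (deriv γ₂ p₀.2.2.1)) :=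
    ⟨_, (hT₁.sub hT₂).prodMk (hB₁.prodMk hB₂), fun _ => rfl⟩
  have h₃' : ∀ j, a j - u₃ ≠ 0 := fun j => (sub_pos.2 (S.lt j)).ne'
  have hinj : Function.Injective (T : ℝ × ℝ × ℝ × ℝ →ₗ[ℝ] E3 × ℝ × ℝ) := by
    rw [← LinearMap.ker_eq_bot, LinearMap.ker_eq_bot']
    rintro ⟨ds, dt, dr, dq⟩ h
    rw [ContinuousLinearMap.coe_coe, hTδ, Prod.mk_eq_zero, Prod.mk_eq_zero] at h
    obtain ⟨h1, h2, h3⟩ := h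
    have n₁ := hv.bil_normal_eq_zero (σ := p₀.2.1) S.sub_ne_zero h₃' S.lt'.ne' (hP₁ ▸ hQ)
    have n₂ := hw'.bil_normal_eq_zero (σ := -p₀.2.2.2) S.sub_ne_zero h₃' S.lt'.ne' (hP₂ ▸ hQ)
    rw [← hP₁] at n₁
    rw [← hP₂] at n₂
    simp only [bil_smul_right, n₁, mul_zero, zero_add] at h2
    simp only [bil_smul_right, n₂, mul_zero, zero_add] at h3
    have hz := hT₁' (ds, dt, dr, dq)
    have hz₂ := hT₂' (ds, dt, dr, dq)
    rw [smul_smul] at hz hz₂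
    have h0 := eq_zero_of_conjugate hv hw' hP₁ hP₂ S.sub_ne_zero S.lt S.lt' hl hlP hκ hw hQ
      hz h2 h3
    rw [h0, zero_sub, neg_eq_zero] at h1
    rw [h0] at hz
    rw [h1] at hz₂
    obtain ⟨i1, i2⟩ := hv.eq_zero_of_smul_add hz.symm
    obtain ⟨j1, j2⟩ := hw'.eq_zero_of_smul_add hz₂.symm
    have hds : ds = 0 := by simpa [hp.1.2.1.ne', hk₁] using i2
    have hdr : dr = 0 := by simpa [hp.1.2.2.2.1.ne', hk₂] using j2
    simp only [hds, hdr, zero_add, zero_sub, neg_eq_zero] at i1 j1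
    rw [hds, i1, hdr, j1]
    rfl
  obtain ⟨K, -, hK⟩ := LinearMap.exists_antilipschitzWith _ (LinearMap.ker_eq_bot.2 hinj)
  filter_upwards [hT.eventually_ne (c := 0) ⟨K, hK⟩] with p hne hpM
  obtain ⟨hpM, hpQ⟩ := hpM
  have t₁ := (S.fst.isTangentLine _ hpM.1).tangent_at (σ := p.2.1)
  have t₂ := (S.snd.isTangentLine _ hpM.2.2.1).tangent_at (σ := -p.2.2.2)
  rw [← meetPoint_eq hpM, hpQ, mul_zero, pow_eq_zero_iff two_ne_zero] at t₂
  change bil a u₂ (meetPoint γ₁ p) _ ^ 2 = _ * Q a u₂ (meetPoint γ₁ p) at t₁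
  rw [hpQ, mul_zero, pow_eq_zero_iff two_ne_zero] at t₁
  exact hne (by rw [meetGap_eq_zero hpM, t₁, t₂]; rfl)

end ThreadSetup

/-! ### The ellipsoid of a vertex and the length of the thread -/

section Parameter

variable {a : Fin 3 → ℝ} {l κ : ℝ} {v w P : E3}

/-- The parameter of the confocal ellipsoid through `P` that reflects the direction `v` to `w`,
as a smooth function of `v`, `w` and `P`. -/
noncomputable def mirrorParam (a : Fin 3 → ℝ) (v w P : E3) : ℝ :=
  (∑ j, a j * (v j - w j) ^ 2 - (∑ j, (v j - w j) * P j) ^ 2) / ∑ j, (v j - w j) ^ 2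

lemma mirrorParam_eq (hl : ∀ j, a j - l ≠ 0) (hP : Q a l P = 0) (hκ : κ ≠ 0)
    (hw : w = v - κ • normal a l P) : mirrorParam a v w P = l := by
  have hd : ∀ j, v j - w j = κ * (P j / (a j - l)) := fun j => by simp [hw, normal]
  have hn : ∑ j, (v j - w j) ^ 2 ≠ 0 := by
    have : ∑ j, (v j - w j) ^ 2 = ‖κ • normal a l P‖ ^ 2 := by
      rw [EuclideanSpace.real_norm_sq_eq]
      exact Finset.sum_congr rfl fun j _ => by rw [hd]; rfl
    rw [this]
    exact pow_ne_zero 2 (norm_ne_zero_iff.2 (smul_ne_zero hκ (normal_ne_zero_of_Q P hP)))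
  have h1 : ∑ j, (v j - w j) * P j = κ := by
    have : ∑ j, (v j - w j) * P j = κ * ∑ j, P j ^ 2 / (a j - l) := by
      rw [Finset.mul_sum]
      exact Finset.sum_congr rfl fun j _ => by rw [hd]; ring
    rw [this, sub_eq_zero.1 hP, mul_one]
  have h2 : ∑ j, a j * (v j - w j) ^ 2 = l * ∑ j, (v j - w j) ^ 2 + κ ^ 2 := by
    have : κ ^ 2 = κ ^ 2 * ∑ j, P j ^ 2 / (a j - l) := by rw [sub_eq_zero.1 hP, mul_one]
    rw [this, Finset.mul_sum, Finset.mul_sum, ← Finset.sum_add_distrib]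
    refine Finset.sum_congr rfl fun j _ => ?_
    have := hl j
    rw [hd]
    field_simp
    ring
  rw [mirrorParam, h1, h2, add_sub_cancel_right, mul_div_cancel_right₀ _ hn]

lemma sum_sub_sq_ne_zero (h : v ≠ w) : ∑ j, (v j - w j) ^ 2 ≠ 0 := by
  have : ∑ j, (v j - w j) ^ 2 = ‖v - w‖ ^ 2 := by
    rw [EuclideanSpace.real_norm_sq_eq]; rfl
  rw [this]
  exact pow_ne_zero 2 (norm_ne_zero_iff.2 (sub_ne_zero.2 h))

/-- Along a curve of points of confocal ellipsoids whose velocity is tangent to the ellipsoids, the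
parameter of the ellipsoid is stationary. -/
lemma deriv_eq_zero_of_tangent {f : ℝ → ℝ} {g : ℝ → E3} {f' s : ℝ} {z : E3}
    (hf : HasDerivAt f f' s) (hg : HasDerivAt g z s) (hne : ∀ j, a j - f s ≠ 0)
    (hQ : ∀ᶠ s' in 𝓝 s, Q a (f s') (g s') = 0) (hz : inner ℝ z (normal a (f s) (g s)) = 0) :
    f' = 0 := by
  have hgj : ∀ j, HasDerivAt (fun s => g s j) (z j) s := fun j =>
    (EuclideanSpace.proj j : E3 →L[ℝ] ℝ).hasFDerivAt.comp_hasDerivAt s hg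
  have h1 : HasDerivAt (fun s => Q a (f s) (g s))
      (∑ j, ((2 * g s j * z j) * (a j - f s) - g s j ^ 2 * (-f')) / (a j - f s) ^ 2) s := by
    refine HasDerivAt.sub_const 1 (HasDerivAt.fun_sum fun j _ => ?_)
    have h2 := ((hgj j).fun_pow 2).fun_div (hf.const_sub (a j)) (hne j)
    simpa using h2
  have h2 : HasDerivAt (fun s => Q a (f s) (g s)) 0 s :=
    (hasDerivAt_const s (0 : ℝ)).congr_of_eventuallyEq hQ
  have h3 := h1.unique h2
  have h4 : ∑ j, ((2 * g s j * z j) * (a j - f s) - g s j ^ 2 * (-f')) / (a j - f s) ^ 2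
      = 2 * inner ℝ z (normal a (f s) (g s)) + f' * ‖normal a (f s) (g s)‖ ^ 2 := by
    rw [inner_normal_right, EuclideanSpace.real_norm_sq_eq, bil, Finset.mul_sum, Finset.mul_sum,
      ← Finset.sum_add_distrib]
    refine Finset.sum_congr rfl fun j _ => ?_
    have := hne j
    simp only [normal]
    field_simp
    ring
  rw [h4, hz, mul_zero, zero_add] at h3
  exact (mul_eq_zero.1 h3).resolve_right
    (pow_ne_zero 2 (norm_ne_zero_iff.2 (normal_ne_zero_of_Q _ hQ.self_of_nhds)))

end Parameter

/-- A continuous real function is constant on a preconnected set if it is locally constant there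
away from a countable set: it takes countably many values. -/
lemma eq_of_isPreconnected_of_countable {X : Type*} [TopologicalSpace X]
    [SecondCountableTopology X] {C E : Set X} {f : X → ℝ} (hf : ContinuousOn f C)
    (hC : IsPreconnected C) (hE : E.Countable)
    (hloc : ∀ p ∈ C, p ∉ E → ∃ U ∈ 𝓝 p, ∀ q ∈ C ∩ U, f q = f p) {p q : X} (hp : p ∈ C)
    (hq : q ∈ C) : f p = f q := by
  have hcount : (f '' C).Countable := by
    have hU : ∀ p : X, ∃ U, p ∈ C \ E → U ∈ 𝓝 p ∧ ∀ q ∈ C ∩ U, f q = f p := by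
      intro p
      by_cases h : p ∈ C \ E
      · obtain ⟨U, hU⟩ := hloc p h.1 h.2
        exact ⟨U, fun _ => hU⟩
      · exact ⟨univ, fun h' => absurd h' h⟩
    choose U hU using hU
    obtain ⟨t, htC, ht, hcov⟩ := TopologicalSpace.countable_cover_nhdsWithin (s := C \ E)
      (f := U) fun p hp => mem_nhdsWithin_of_mem_nhds (hU p hp).1
    refine ((ht.image f).union (hE.image f)).mono ?_
    rintro _ ⟨p, hp, rfl⟩
    by_cases h : p ∈ E
    · exact Or.inr ⟨p, h, rfl⟩
    · obtain ⟨r, hr, hpr⟩ := mem_iUnion₂.1 (hcov ⟨hp, h⟩)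
      exact Or.inl ⟨r, hr, ((hU r (htC hr)).2 p ⟨hp, hpr⟩).symm⟩
  exact hcount.isTotallyDisconnected _ Subset.rfl (hC.image f hf) ⟨p, hp, rfl⟩ ⟨q, hq, rfl⟩

/-- A set all of whose points are isolated in it is countable. -/
lemma countable_of_isolated {X : Type*} [TopologicalSpace X] [SecondCountableTopology X] {E : Set X}
    (h : ∀ p ∈ E, ∀ᶠ q in 𝓝[≠] p, q ∉ E) : E.Countable := by
  have hs : ∀ p ∈ E, {p} ∈ 𝓝[E] p := by
    intro p hp
    have := h p hp
    rw [eventually_nhdsWithin_iff] at this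
    rw [mem_nhdsWithin_iff_eventually]
    filter_upwards [this] with q hq hqE
    by_contra hne
    exact hq hne hqE
  obtain ⟨t, -, ht, hcov⟩ := TopologicalSpace.countable_cover_nhdsWithin hs
  exact ht.mono (by simpa using hcov)

namespace ThreadSetup

variable {a : Fin 3 → ℝ} {u₂ u₃ : ℝ} {γ₁ γ₂ : ℝ → E3} {I₁ I₂ : Set ℝ}
  {p p₀ : ℝ × ℝ × ℝ × ℝ}

lemma deriv_ne_deriv (S : ThreadSetup a u₂ u₃ γ₁ γ₂ I₁ I₂)
    (hp : p ∈ vertexSet a γ₁ γ₂ I₁ I₂) : deriv γ₁ p.1 ≠ deriv γ₂ p.2.2.1 := by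
  obtain ⟨l, hl, hlP, κ, hκ, hw⟩ := S.exists_vertex hp
  intro h
  rw [h, eq_comm, sub_eq_self] at hw
  exact smul_ne_zero hκ (normal_ne_zero_of_Q _ hlP) hw

lemma continuousAt_mirrorParam (S : ThreadSetup a u₂ u₃ γ₁ γ₂ I₁ I₂)
    (hp : p ∈ vertexSet a γ₁ γ₂ I₁ I₂) :
    ContinuousAt (fun p : ℝ × ℝ × ℝ × ℝ =>
      mirrorParam a (deriv γ₁ p.1) (deriv γ₂ p.2.2.1) (meetPoint γ₁ p)) p := by
  have hj : ∀ {h : ℝ × ℝ × ℝ × ℝ → E3}, ContinuousAt h p → ∀ j,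
      ContinuousAt (fun p => h p j) p := fun h j =>
    (EuclideanSpace.proj j : E3 →L[ℝ] ℝ).continuous.continuousAt.comp h
  have hj₁ := hj (S.continuousAt_deriv_fst hp.1.1)
  have hj₂ := hj (S.continuousAt_deriv_snd hp.1.2.2.1)
  have hjP := hj (S.continuousAt_meetPoint hp.1.1)
  have h₁ : ContinuousAt (fun p : ℝ × ℝ × ℝ × ℝ =>
      ∑ j, a j * (deriv γ₁ p.1 j - deriv γ₂ p.2.2.1 j) ^ 2) p :=
    tendsto_finsetSum _ fun j _ => (((hj₁ j).sub (hj₂ j)).pow 2).const_mul _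
  have h₂ : ContinuousAt (fun p : ℝ × ℝ × ℝ × ℝ =>
      ∑ j, (deriv γ₁ p.1 j - deriv γ₂ p.2.2.1 j) * meetPoint γ₁ p j) p :=
    tendsto_finsetSum _ fun j _ => ((hj₁ j).sub (hj₂ j)).mul (hjP j)
  have h₃ : ContinuousAt (fun p : ℝ × ℝ × ℝ × ℝ =>
      ∑ j, (deriv γ₁ p.1 j - deriv γ₂ p.2.2.1 j) ^ 2) p :=
    tendsto_finsetSum _ fun j _ => ((hj₁ j).sub (hj₂ j)).pow 2
  exact (h₁.sub (h₂.pow 2)).div h₃ (sum_sub_sq_ne_zero (S.deriv_ne_deriv hp))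

/-- The ellipsoid of a vertex and the length of the thread are constant along the curve of
vertices near a vertex outside of the quadric `u₂`. -/
lemma exists_locally_const (S : ThreadSetup a u₂ u₃ γ₁ γ₂ I₁ I₂)
    (hp : p₀ ∈ vertexSet a γ₁ γ₂ I₁ I₂) (hQ : Q a u₂ (meetPoint γ₁ p₀) ≠ 0) :
    ∃ U ∈ 𝓝 p₀, ∀ p ∈ meetSet γ₁ γ₂ I₁ I₂ ∩ U,
      mirrorParam a (deriv γ₁ p.1) (deriv γ₂ p.2.2.1) (meetPoint γ₁ p)
        = mirrorParam a (deriv γ₁ p₀.1) (deriv γ₂ p₀.2.2.1) (meetPoint γ₁ p₀) ∧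
      p.1 + p.2.1 + p.2.2.2 - p.2.2.1 = p₀.1 + p₀.2.1 + p₀.2.2.2 - p₀.2.2.1 := by
  obtain ⟨U, hU, ε, hε, c, hc, hMU, hMV, hMQ⟩ := S.exists_curve hp hQ
  set J := Ioo (p₀.1 - ε) (p₀.1 + ε) with hJ
  have hJo : IsOpen J := isOpen_Ioo
  have hmem : ∀ s ∈ J, (s, c s) ∈ meetSet γ₁ γ₂ I₁ I₂ ∩ U := fun s hs => hMU ▸ ⟨s, hs, rfl⟩
  have key : ∀ s ∈ J,
      HasDerivAt (fun s => mirrorParam a (deriv γ₁ s) (deriv γ₂ (c s).2.1)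
        (meetPoint γ₁ (s, c s))) 0 s ∧
      HasDerivAt (fun s => s + (c s).1 + (c s).2.2 - (c s).2.1) 0 s := by
    intro s hs
    have hM : ∀ᶠ s' in 𝓝 s, (s', c s') ∈ meetSet γ₁ γ₂ I₁ I₂ ∩ U :=
      Filter.eventually_of_mem (hJo.mem_nhds hs) hmem
    have hcs : HasDerivAt c (deriv c s) s :=
      ((hc.contDiffAt (hJo.mem_nhds hs)).differentiableAt one_ne_zero).hasDerivAt
    obtain ⟨z, k₁, k₂, -, hz, hz₁, hz₂⟩ :=
      S.exists_hasDerivAt_meetPoint hcs (hM.mono fun _ h => h.1)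
    have hsM := (hmem s hs).1
    have hr : HasDerivAt (fun s => (c s).2.1) (deriv c s).2.1 s := hcs.snd.fst
    obtain ⟨l, hl, hlP, κ, hκ, hw⟩ := S.exists_vertex (hMV (hmem s hs))
    have hv₁ := S.fst.isTangentLine _ hsM.1
    have hv₂ := S.snd.isTangentLine _ hsM.2.2.1
    have hzn : inner ℝ z (normal a l (meetPoint γ₁ (s, c s))) = 0 :=
      inner_normal_eq_zero_of_tangent hv₁ hv₂ rfl (meetPoint_eq hsM) S.sub_ne_zero
        S.lt S.lt' hl hlP hκ hw (hMQ _ (hmem s hs)) hz₁ hz₂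
    constructor
    · have hd₁ : DifferentiableAt ℝ (deriv γ₁) s :=
        (S.fst.contDiffAt_deriv _ hsM.1).differentiableAt one_ne_zero
      have hd₂ : DifferentiableAt ℝ (fun s => deriv γ₂ (c s).2.1) s :=
        ((S.snd.contDiffAt_deriv _ hsM.2.2.1).differentiableAt one_ne_zero).comp
          (f := fun s => (c s).2.1) s hr.differentiableAt
      have hdP := hz.differentiableAt
      have hj : ∀ {h : ℝ → E3}, DifferentiableAt ℝ h s → ∀ j,
          DifferentiableAt ℝ (fun s => h s j) s := fun h j =>
        (EuclideanSpace.proj j : E3 →L[ℝ] ℝ).differentiableAt.comp s h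
      have hj₁ := hj hd₁
      have hj₂ := hj hd₂
      have hjP := hj hdP
      have hden := sum_sub_sq_ne_zero (S.deriv_ne_deriv (hMV (hmem s hs)))
      have hdiff : DifferentiableAt ℝ (fun s => mirrorParam a (deriv γ₁ s) (deriv γ₂ (c s).2.1)
          (meetPoint γ₁ (s, c s))) s := by
        unfold mirrorParam
        refine DifferentiableAt.fun_div ?_ ?_ hden
        · exact (DifferentiableAt.fun_sum fun j _ => (((hj₁ j).sub (hj₂ j)).pow 2).const_mul _).sub
            ((DifferentiableAt.fun_sum fun j _ => ((hj₁ j).sub (hj₂ j)).mul (hjP j)).pow 2)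
        · exact DifferentiableAt.fun_sum fun j _ => ((hj₁ j).sub (hj₂ j)).pow 2
      have hval : mirrorParam a (deriv γ₁ s) (deriv γ₂ (c s).2.1) (meetPoint γ₁ (s, c s)) = l :=
        mirrorParam_eq (fun j => (sub_pos.2 (hl.trans (S.lt j))).ne') hlP hκ hw
      have h0 := deriv_eq_zero_of_tangent hdiff.hasDerivAt hz
        (by rw [hval]; exact fun j => (sub_pos.2 (hl.trans (S.lt j))).ne') ?_
        (by rw [hval]; exact hzn)
      · rw [← h0]; exact hdiff.hasDerivAt
      · filter_upwards [hM] with s' hs'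
        obtain ⟨l', hl', hlP', κ', hκ', hw'⟩ := S.exists_vertex (hMV hs')
        rwa [mirrorParam_eq (fun j => (sub_pos.2 (hl'.trans (S.lt j))).ne') hlP' hκ' hw']
    · refine ((((hasDerivAt_id' s).add hcs.fst).add hcs.snd.snd).sub hcs.snd.fst).congr_deriv ?_
      have i₁ : inner ℝ z (deriv γ₁ s) = 1 + (deriv c s).1 := by
        rw [hz₁, inner_add_left, inner_smul_left, inner_smul_left, real_inner_comm,
          real_inner_comm (deriv γ₁ s) (normal a u₃ _), hv₁.inner_self, hv₁.inner_normal]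
        simp
      have i₂ : inner ℝ z (deriv γ₂ (c s).2.1) = (deriv c s).2.1 - (deriv c s).2.2 := by
        rw [hz₂, inner_add_left, inner_smul_left, inner_smul_left, real_inner_comm,
          real_inner_comm (deriv γ₂ (c s).2.1) (normal a u₃ _), hv₂.inner_self, hv₂.inner_normal]
        simp
      change deriv γ₂ (c s).2.1 = deriv γ₁ s - _ at hw
      rw [hw, inner_sub_right, inner_smul_right, hzn, i₁] at i₂
      linarith
  have hconst : ∀ f : ℝ → ℝ, (∀ s ∈ J, HasDerivAt f 0 s) → ∀ s ∈ J, f s = f p₀.1 := by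
    intro f hf s hs
    exact hJo.is_const_of_deriv_eq_zero isPreconnected_Ioo
      (fun x hx => (hf x hx).differentiableAt.differentiableWithinAt) (fun x hx => (hf x hx).deriv)
      hs ⟨by linarith, by linarith⟩
  have hp₀ : (p₀.1, c p₀.1) = p₀ := by
    have h : p₀ ∈ meetSet γ₁ γ₂ I₁ I₂ ∩ U := ⟨hp.1, mem_of_mem_nhds hU⟩
    rw [hMU] at h
    obtain ⟨s, hs, rfl⟩ := h
    rfl
  refine ⟨U, hU, fun p hpM => ?_⟩
  rw [hMU] at hpM
  obtain ⟨s, hs, rfl⟩ := hpM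
  have e₁ := hconst _ (fun s hs => (key s hs).1) s hs
  have e₂ := hconst _ (fun s hs => (key s hs).2) s hs
  have hp₂ : c p₀.1 = p₀.2 := congrArg Prod.snd hp₀
  simp only [hp₂] at e₁ e₂
  exact ⟨e₁, e₂⟩

lemma threadLength_eq (S : ThreadSetup a u₂ u₃ γ₁ γ₂ I₁ I₂) {α β : ℝ} (hα : α ∈ I₁)
    (hβ : β ∈ I₂) (hp : p ∈ meetSet γ₁ γ₂ I₁ I₂) :
    threadLength γ₁ γ₂ α β p = p.1 + p.2.1 + p.2.2.2 - p.2.2.1 + (β - α) := by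
  have hint : ∀ {γ : ℝ → E3} {I : Set ℝ}, IsTangentFamily a u₂ u₃ γ I → ∀ {x y : ℝ}, x ∈ I →
      y ∈ I → ∫ s in x..y, ‖deriv γ s‖ = y - x := by
    intro γ I h x y hx hy
    have : EqOn (fun s => ‖deriv γ s‖) (fun _ => 1) (uIcc x y) := fun s hs =>
      (h.isTangentLine s (h.ordConnected.uIcc_subset hx hy hs)).norm_eq_one
    rw [intervalIntegral.integral_congr this]
    simp
  have h₁ : dist (γ₁ p.1) (meetPoint γ₁ p) = p.2.1 := by
    rw [meetPoint, tangentPoint, dist_self_add_right, norm_smul,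
      (S.fst.isTangentLine _ hp.1).norm_eq_one, mul_one, Real.norm_of_nonneg hp.2.1.le]
  have h₂ : dist (meetPoint γ₁ p) (γ₂ p.2.2.1) = p.2.2.2 := by
    rw [meetPoint_eq hp, dist_self_add_left, norm_smul,
      (S.snd.isTangentLine _ hp.2.2.1).norm_eq_one, mul_one, norm_neg,
      Real.norm_of_nonneg hp.2.2.2.1.le]
  rw [threadLength, hint S.fst hα hp.1, hint S.snd hp.2.2.1 hβ, h₁, h₂]
  ring

/-- The vertices on the quadric `u₂` are countable in number, so they cannot disconnect a connected
set of vertices into parts with different ellipsoids or lengths. -/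
lemma eq_of_isPreconnected (S : ThreadSetup a u₂ u₃ γ₁ γ₂ I₁ I₂) {C : Set (ℝ × ℝ × ℝ × ℝ)}
    (hCV : C ⊆ vertexSet a γ₁ γ₂ I₁ I₂) (hC : IsPreconnected C) (hp : p ∈ C) (hp₀ : p₀ ∈ C) :
    mirrorParam a (deriv γ₁ p.1) (deriv γ₂ p.2.2.1) (meetPoint γ₁ p)
        = mirrorParam a (deriv γ₁ p₀.1) (deriv γ₂ p₀.2.2.1) (meetPoint γ₁ p₀) ∧
      p.1 + p.2.1 + p.2.2.2 - p.2.2.1 = p₀.1 + p₀.2.1 + p₀.2.2.2 - p₀.2.2.1 := by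
  have hE : {p ∈ vertexSet a γ₁ γ₂ I₁ I₂ | Q a u₂ (meetPoint γ₁ p) = 0}.Countable :=
    countable_of_isolated fun p hp => (S.eventually_ne_of_Q_eq_zero hp.1 hp.2).mono
      fun q hq h => hq ⟨h.1.1, h.2⟩
  have key : ∀ f : ℝ × ℝ × ℝ × ℝ → ℝ, ContinuousOn f C →
      (∀ p ∈ vertexSet a γ₁ γ₂ I₁ I₂, Q a u₂ (meetPoint γ₁ p) ≠ 0 →
        ∃ U ∈ 𝓝 p, ∀ q ∈ meetSet γ₁ γ₂ I₁ I₂ ∩ U, f q = f p) → f p = f p₀ := by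
    intro f hf hloc
    refine eq_of_isPreconnected_of_countable hf hC hE (fun p hp hpE => ?_) hp hp₀
    obtain ⟨U, hU, h⟩ := hloc p (hCV hp) fun h0 => hpE ⟨hCV hp, h0⟩
    exact ⟨U, hU, fun q hq => h q ⟨(hCV hq.1).1, hq.2⟩⟩
  have h₁ := key
    (fun p => mirrorParam a (deriv γ₁ p.1) (deriv γ₂ p.2.2.1) (meetPoint γ₁ p))
    (fun p hp => (S.continuousAt_mirrorParam (hCV hp)).continuousWithinAt) fun p hp hQ => by
      obtain ⟨U, hU, h⟩ := S.exists_locally_const hp hQ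
      exact ⟨U, hU, fun q hq => (h q hq).1⟩
  have h₂ := key (fun p => p.1 + p.2.1 + p.2.2.2 - p.2.2.1) (by fun_prop) fun p hp hQ => by
    obtain ⟨U, hU, h⟩ := S.exists_locally_const hp hQ
    exact ⟨U, hU, fun q hq => (h q hq).2⟩
  exact ⟨h₁, h₂⟩

end ThreadSetup

end Confocal

theorem proposition5p1
    (a : Fin 3 → ℝ) (ha₀₁ : a 1 < a 0) (ha₁₂ : a 2 < a 1)
    (u₂ u₃ : ℝ) (hu₂ : a 2 < u₂) (hu₂' : u₂ < a 1) (hu₃ : u₃ < a 2)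
    (γ₁ γ₂ : ℝ → Confocal.E3) (I₁ I₂ : Set ℝ)
    (hγ₁ : Confocal.IsGeodesicOn a u₃ γ₁ I₁) (hγ₂ : Confocal.IsGeodesicOn a u₃ γ₂ I₂)
    (ht₁ : Confocal.TangentsTangentTo a u₂ γ₁ I₁)
    (ht₂ : Confocal.TangentsTangentTo a u₂ γ₂ I₂) :
    -- near a vertex outside the hyperboloid the two surfaces meet exactly along a regular curve,
    -- all of whose points are vertices
    (∀ p₀ ∈ Confocal.vertexSet a γ₁ γ₂ I₁ I₂,
      Confocal.meetPoint γ₁ p₀ ∉ Confocal.quadric a u₂ →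
      ∃ U ∈ 𝓝 p₀, ∃ ε > 0, ∃ c : ℝ → ℝ × ℝ × ℝ,
        ContDiffOn ℝ 1 c (Ioo (p₀.1 - ε) (p₀.1 + ε)) ∧
        Confocal.meetSet γ₁ γ₂ I₁ I₂ ∩ U =
          (fun s => (s, c s)) '' Ioo (p₀.1 - ε) (p₀.1 + ε) ∧
        (∀ s ∈ Ioo (p₀.1 - ε) (p₀.1 + ε),
          deriv (fun s' => Confocal.meetPoint γ₁ (s', c s')) s ≠ 0) ∧
        Confocal.meetSet γ₁ γ₂ I₁ I₂ ∩ U ⊆ Confocal.vertexSet a γ₁ γ₂ I₁ I₂) ∧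
    -- each connected set of vertices lies on one confocal ellipsoid outside the given one, and
    -- the length of the thread is constant on it
    (∀ C ⊆ Confocal.vertexSet a γ₁ γ₂ I₁ I₂, IsPreconnected C →
      (∃ u₃' : ℝ, u₃' < u₃ ∧ ∀ p ∈ C, Confocal.meetPoint γ₁ p ∈ Confocal.quadric a u₃') ∧
      ∀ α ∈ I₁, ∀ β ∈ I₂, ∃ L : ℝ, ∀ p ∈ C, Confocal.threadLength γ₁ γ₂ α β p = L) := by
  have hle : ∀ j, a 2 ≤ a j := by
    intro j
    fin_cases j
    exacts [(ha₁₂.trans ha₀₁).le, ha₁₂.le, le_rfl]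
  have hlt : ∀ j, u₃ < a j := fun j => hu₃.trans_le (hle j)
  have hne : ∀ j, a j - u₂ ≠ 0 := by
    intro j
    rw [sub_ne_zero]
    fin_cases j
    exacts [(hu₂'.trans ha₀₁).ne', hu₂'.ne', hu₂.ne]
  have S : Confocal.ThreadSetup a u₂ u₃ γ₁ γ₂ I₁ I₂ :=
    ⟨hγ₁.isTangentFamily ht₁ hlt, hγ₂.isTangentFamily ht₂ hlt, hle, hlt, hne, hu₃.trans hu₂⟩
  constructor
  · intro p₀ hp hQ
    obtain ⟨U, hU, ε, hε, c, hc, hMU, hMV, -⟩ := S.exists_curve hp hQ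
    refine ⟨U, hU, ε, hε, c, hc, hMU, fun s hs => ?_, hMV⟩
    have hmem : ∀ s ∈ Ioo (p₀.1 - ε) (p₀.1 + ε), (s, c s) ∈ Confocal.meetSet γ₁ γ₂ I₁ I₂ ∩ U :=
      fun s hs => hMU ▸ ⟨s, hs, rfl⟩
    have hcs := ((hc.contDiffAt (isOpen_Ioo.mem_nhds hs)).differentiableAt one_ne_zero).hasDerivAt
    obtain ⟨z, k₁, k₂, hk₁, hz, hz₁, -⟩ := S.exists_hasDerivAt_meetPoint hcs
      (Filter.eventually_of_mem (isOpen_Ioo.mem_nhds hs) fun s hs => (hmem s hs).1)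
    rw [hz.deriv]
    rintro rfl
    exact hk₁ ((S.fst.isTangentLine s (hmem s hs).1.1).eq_zero_of_smul_add hz₁.symm).2
  · intro C hCV hC
    rcases C.eq_empty_or_nonempty with rfl | ⟨p₀, hp₀⟩
    · exact ⟨⟨u₃ - 1, by linarith, by simp⟩, fun _ _ _ _ => ⟨0, by simp⟩⟩
    refine ⟨?_, fun α hα β hβ => ⟨Confocal.threadLength γ₁ γ₂ α β p₀, fun p hp => ?_⟩⟩
    · have hval : ∀ p ∈ C, ∃ l < u₃, Confocal.Q a l (Confocal.meetPoint γ₁ p) = 0 ∧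
          Confocal.mirrorParam a (deriv γ₁ p.1) (deriv γ₂ p.2.2.1) (Confocal.meetPoint γ₁ p)
            = l := by
        intro p hp
        obtain ⟨l, hl, hlP, κ, hκ, hw⟩ := S.exists_vertex (hCV hp)
        exact ⟨l, hl, hlP, Confocal.mirrorParam_eq
          (fun j => (sub_pos.2 (hl.trans (hlt j))).ne') hlP hκ hw⟩
      obtain ⟨l, hl, -, hl'⟩ := hval p₀ hp₀
      refine ⟨l, hl, fun p hp => ?_⟩
      obtain ⟨m, -, hmP, hm⟩ := hval p hp
      have hml : m = l := by rw [← hm, ← hl', (S.eq_of_isPreconnected hCV hC hp hp₀).1]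
      exact hml ▸ hmP
    · rw [S.threadLength_eq hα hβ (hCV hp).1, S.threadLength_eq hα hβ (hCV hp₀).1,
        (S.eq_of_isPreconnected hCV hC hp hp₀).2]
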